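/- A range space is a pair $(\mathcal X,\mathcal R)$, where $\mathcal X$ is a finite set equipped with a probability measure $\mathrm P$ (defined on all subsets) and $\mathcal R\subset 2^{\mathcal X}$. For $r>0$ let $\mathcal R_{\le r}=\{R\in\mathcal R:\mathrm P(R)\le r\}$, and for a family $\mathcal Q\subset 2^{\mathcal X}$ let $\mathcal M(\mathcal Q,r)$ be the largest size of a subfamily of $\mathcal Q$ in which any two distinct members $A,B$ satisfy $\mathrm P(A\mathbin{\Delta}B)\ge r$. For $\epsilon>0$ define the doubling constant and Alexander's capacity by $$D_\epsilon=\sup_{\epsilon_0\ge\epsilon}\mathcal M(\mathcal R_{\le 2\epsilon_0},\epsilon_0),\qquad \tau(\epsilon)=\max\Big\{1,\ \sup_{\epsilon_0\ge\epsilon}\frac{\mathrm P\big(\bigcup_{R\in\mathcal R_{\le\epsilon_0}}R\big)}{\epsilon_0}\Big\}.$$ The VC-dimension $d$ of $(\mathcal X,\mathcal R)$ is the largest size of a set $Y\subseteq\mathcal X$ with $\{R\cap Y:R\in\mathcal R\}=2^Y$. An $\epsilon$-net is a set $S$ of points of $\mathcal X$ of positive measure that meets every $R\in\mathcal R$ with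 $\mathrm P(R)\ge\epsilon$. For a family $\mathcal G$ of subsets of $\mathbb R^n$, the range space induced by $\mathcal G$ on a finite set $\mathcal X\subset\mathbb R^n$ has $\mathcal R=\{\mathcal X\cap G:G\in\mathcal G\}$. Consider the range spaces induced by half-spaces in $\mathbb R^2$, by half-spaces in $\mathbb R^3$, by discs in $\mathbb R^2$, by intervals in $\mathbb R$, and all range spaces of VC-dimension $1$ (half-spaces, discs and intervals are taken closed; since $\mathcal X$ is finite, open ones induce the same ranges). Then: (1) There is an absolute constant $C$ such that $D_\epsilon\le C\,\tau(\epsilon)$ for every such range space and every $\epsilon>0$. (2) For every $a<1$ there is a constant $C$, depending only on $a$, such that for every $\epsilon\in(0,a]$ every such range space, of VC-dimension $d$, has an $\epsilon$-net of size at most $$C\,d\,\min\Big\{\tau(\epsilon)\log\frac1\epsilon,\ \frac1\epsilon\Big\}.$$ -/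

import Mathlib

open MeasureTheory

universe u

/-! Range spaces `(X, 𝓡)` on a finite set `X`, with a probability measure `P` on `X`. Every subset
of `X` is measurable (finite set, measurable singletons), and the ranges are finsets of `X`. -/

namespace RangeSpace

section

variable {X : Type*} [MeasurableSpace X]

/-- `𝓡_{≤ r}`: the ranges of measure at most `r`. -/
noncomputable def smallRanges (P : Measure X) (𝓡 : Finset (Finset X)) (r : ℝ) :
    Finset (Finset X) :=
  𝓡.filter fun R => P.real (R : Set X) ≤ r

/-- Alexander's capacity
`τ(ε) = max {1, sup_{ε₀ ≥ ε} P(⋃ 𝓡_{≤ ε₀}) / ε₀}`. -/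
noncomputable def capacity (P : Measure X) (𝓡 : Finset (Finset X)) (ε : ℝ) : ℝ :=
  max (⨆ ε₀ : Set.Ici ε, P.real (⋃ R ∈ smallRanges P 𝓡 ε₀, (R : Set X)) / (ε₀ : ℝ)) 1

/-- The supremum in the definition of the capacity is that of a bounded family. -/
theorem bddAbove_capacity (P : Measure X) [IsProbabilityMeasure P] (𝓡 : Finset (Finset X))
    {ε : ℝ} (hε : 0 < ε) :
    BddAbove (Set.range fun ε₀ : Set.Ici ε =>
      P.real (⋃ R ∈ smallRanges P 𝓡 ε₀, (R : Set X)) / (ε₀ : ℝ)) := by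
  refine ⟨1 / ε, ?_⟩
  rintro _ ⟨⟨ε₀, h⟩, rfl⟩
  have h : ε ≤ ε₀ := h
  exact div_le_div₀ zero_le_one measureReal_le_one hε h

variable [DecidableEq X]

/-- The packing number `M(𝓡, r)`: the largest size of a subfamily of `𝓡` whose distinct members
are at distance `P(A ∆ B) ≥ r`. -/
noncomputable def packingNumber (P : Measure X) (𝓡 : Finset (Finset X)) (r : ℝ) : ℕ :=
  (𝓡.powerset.filter fun 𝓠 =>
    ∀ A ∈ 𝓠, ∀ B ∈ 𝓠, A ≠ B → r ≤ P.real ((symmDiff A B : Finset X) : Set X)).sup Finset.card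

/-- The doubling constant `D_ε = sup_{ε₀ ≥ ε} M(𝓡_{≤ 2 ε₀}, ε₀)`. -/
noncomputable def doublingConstant (P : Measure X) (𝓡 : Finset (Finset X)) (ε : ℝ) : ℕ :=
  ⨆ ε₀ : Set.Ici ε, packingNumber P (smallRanges P 𝓡 (2 * ε₀)) ε₀

/-- The supremum in the definition of the doubling constant is that of a bounded family. -/
theorem bddAbove_doublingConstant (P : Measure X) (𝓡 : Finset (Finset X)) (ε : ℝ) :
    BddAbove (Set.range fun ε₀ : Set.Ici ε =>
      packingNumber P (smallRanges P 𝓡 (2 * ε₀)) ε₀) := by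
  refine ⟨𝓡.card, ?_⟩
  rintro _ ⟨ε₀, rfl⟩
  refine Finset.sup_le fun 𝓠 h𝓠 => Finset.card_le_card ?_
  exact (Finset.mem_powerset.1 (Finset.mem_filter.1 h𝓠).1).trans (Finset.filter_subset _ _)

end

/-- `S` is an `ε`-net: it lies in the support of `P` (on a finite set, the points of positive mass)
and meets every range of measure at least `ε`. -/
def IsEpsNet {X : Type*} [MeasurableSpace X] (P : Measure X) (𝓡 : Finset (Finset X)) (ε : ℝ)
    (S : Finset X) : Prop :=
  (∀ x ∈ S, 0 < P {x}) ∧ ∀ R ∈ 𝓡, ε ≤ P.real (R : Set X) → ∃ x ∈ S, x ∈ R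

/-- `𝓡` is induced by the family `𝓖` of subsets of `E`: up to an identification of `X` with a set
of points of `E`, the ranges are exactly the intersections `X ∩ G` with `G ∈ 𝓖`. -/
def IsInducedBy {X E : Type*} (𝓖 : Set (Set E)) (𝓡 : Finset (Finset X)) : Prop :=
  ∃ f : X ↪ E, ∀ R : Finset X, R ∈ 𝓡 ↔ ∃ G ∈ 𝓖, ∀ x, x ∈ R ↔ f x ∈ G

/-- Closed half-spaces of `ℝⁿ`. -/
def halfSpaces (n : ℕ) : Set (Set (EuclideanSpace ℝ (Fin n))) :=
  {H | ∃ (a : EuclideanSpace ℝ (Fin n)) (b : ℝ), a ≠ 0 ∧ H = {x | inner ℝ a x ≤ b}}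

/-- Closed discs of the plane. -/
def discs : Set (Set (EuclideanSpace ℝ (Fin 2))) :=
  {B | ∃ (c : EuclideanSpace ℝ (Fin 2)) (r : ℝ), 0 < r ∧ B = Metric.closedBall c r}

/-- Closed intervals of the line. -/
def intervals : Set (Set ℝ) :=
  {I | ∃ a b : ℝ, a ≤ b ∧ I = Set.Icc a b}

/-- The range spaces under consideration: those induced by half-spaces in `ℝ²` or `ℝ³`, by discs
in `ℝ²`, by intervals in `ℝ`, and those of VC-dimension `1`. -/
def IsAdmissible {X : Type*} [DecidableEq X] (𝓡 : Finset (Finset X)) : Prop :=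
  IsInducedBy (halfSpaces 2) 𝓡 ∨ IsInducedBy (halfSpaces 3) 𝓡 ∨ IsInducedBy discs 𝓡 ∨
    IsInducedBy intervals 𝓡 ∨ 𝓡.vcDim = 1

end RangeSpace

/-! Everything follows from one combinatorial property, `ShallowBound`: on a finite set `Y` the
traces with at most `k` points number O_k(#Y + 1). It forces bounded VC-dimension, so all constants
are absolute.

Packing. Let 𝓠 be an ηr-separated family of ranges of measure at most 2r, contained in a set `U`.
Condition on `U` and draw n of order P(U)/r points. By Haussler's argument
(`mul_card_sub_expected_traces_le`) the expected number of traces of 𝓠 is at least #𝓠/2. A range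
meets the sample in O(1) points on average, so by Markov most ranges have shallow traces, and there
are O(n) of those. Hence #𝓠 = O(P(U)/r + 1). With `U` the union of the small ranges, P(U)/r is at
most twice the capacity, which is (1).

Nets. At scale r take a maximal separated family of ranges of measure in [r, 2r]. Every range of
that scale almost contains some member `A`, and boundedly many points inside `A` hit all such ranges
(`exists_small_net`). The union over the scales 2^k ε has O(log(1/ε)) terms of size O(τ), and the
alternative bounds O(1/(2^k ε)) sum geometrically to O(1/ε).

Geometry. Discs and intervals lift to half-spaces of ℝ³. Dually, points become affine functions on
the plane, and a set cut off by a half-space consists of the lowest functions at some point. Such a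
set is encoded by a shallow vertex of the arrangement and three bits; Clarkson–Shor sampling and the
linear complexity of lower envelopes bound the shallow vertices. For VC-dimension 1 the Sauer–Shelah
bound is already linear. -/

set_option linter.unusedSectionVars false

namespace RangeSpace

open Finset

/-! ### Edges of the hypercube inside a set family -/

/-- A set family whose shattered sets have at most `d` elements induces at most `d * #𝒜` edges of
the hypercube. -/
theorem card_hypercube_edges_le {α : Type*} [DecidableEq α] (s : Finset α) :
    ∀ (𝒜 : Finset (Finset α)) (d : ℕ), (∀ v ∈ 𝒜, v ⊆ s) → (∀ t, 𝒜.Shatters t → #t ≤ d) →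
      ∑ i ∈ s, #{v ∈ 𝒜 | i ∉ v ∧ insert i v ∈ 𝒜} ≤ d * #𝒜 := by
  induction s using Finset.induction_on with
  | empty => intro 𝒜 d _ _; simp
  | insert a s ha ih =>
    intro 𝒜 d h𝒜 hd
    set B := 𝒜.nonMemberSubfamily a with hB
    set D := 𝒜.memberSubfamily a with hD
    have hBs : ∀ v ∈ B, v ⊆ s := by
      intro v hv
      rw [hB, mem_nonMemberSubfamily] at hv
      exact (subset_insert_iff_of_notMem hv.2).1 (h𝒜 v hv.1)
    have hDs : ∀ v ∈ D, v ⊆ s := by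
      intro v hv
      rw [hD, mem_memberSubfamily] at hv
      exact (subset_insert_iff_of_notMem hv.2).1 ((subset_insert a v).trans (h𝒜 _ hv.1))
    have hBD : ∀ t, (B ∪ D).Shatters t → #t ≤ d := by
      intro t ht
      refine hd t fun r hr => ?_
      have hat : a ∉ t := by
        obtain ⟨v, hv, htv⟩ := ht.exists_superset
        intro hat
        exact ha ((union_subset (fun _ h => h) (fun _ h => h) :
          s ∪ s ⊆ s) (mem_union_left _ ((mem_union.1 hv).elim (hBs v) (hDs v) (htv hat))))
      obtain ⟨v, hv, hvr⟩ := ht hr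
      rcases mem_union.1 hv with hv | hv
      · exact ⟨v, (mem_nonMemberSubfamily.1 hv).1, hvr⟩
      · exact ⟨insert a v, (mem_memberSubfamily.1 hv).1, by
          rw [inter_insert_of_notMem hat, hvr]⟩
    -- Members of `B ∩ D` occur in `𝒜` both with and without `a`, so `a` is shattered along with
    -- `t`. The dimension gained here pays for the `#(B ∩ D)` edges in direction `a`.
    have hcap : ∀ t, (B ∩ D).Shatters t → #t + 1 ≤ d := by
      intro t ht
      have hat : a ∉ t := by
        obtain ⟨v, hv, htv⟩ := ht.exists_superset
        exact fun hat => ha (hBs v (mem_inter.1 hv).1 (htv hat))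
      rw [← card_insert_of_notMem hat]
      refine hd _ fun r hr => ?_
      obtain ⟨v, hv, hvr⟩ := ht (subset_insert_iff.1 hr)
      rw [mem_inter, hB, hD, mem_nonMemberSubfamily, mem_memberSubfamily] at hv
      by_cases har : a ∈ r
      · exact ⟨insert a v, hv.2.1, by rw [← insert_inter_distrib, hvr, insert_erase har]⟩
      · refine ⟨v, hv.1.1, ?_⟩
        rw [insert_inter_of_notMem hv.1.2, hvr, erase_eq_of_notMem har]
    have h1 : #{v ∈ 𝒜 | a ∉ v ∧ insert a v ∈ 𝒜} = #(B ∩ D) := by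
      congr 1
      ext v
      simp only [mem_filter, hB, hD, mem_inter, mem_nonMemberSubfamily, mem_memberSubfamily]
      tauto
    have h2 : ∀ i ∈ s, #{v ∈ 𝒜 | i ∉ v ∧ insert i v ∈ 𝒜} ≤
        #{v ∈ B ∪ D | i ∉ v ∧ insert i v ∈ B ∪ D} +
          #{v ∈ B ∩ D | i ∉ v ∧ insert i v ∈ B ∩ D} := by
      intro i hi
      have hia : i ≠ a := fun h => ha (h ▸ hi)
      have e1 : #{v ∈ 𝒜 | i ∉ v ∧ insert i v ∈ 𝒜} ≤
          #{v ∈ B | i ∉ v ∧ insert i v ∈ B} + #{v ∈ D | i ∉ v ∧ insert i v ∈ D} := by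
        rw [← card_filter_add_card_filter_not (fun v => a ∉ v)]
        refine Nat.add_le_add (card_le_card fun v => ?_) ?_
        · simp only [mem_filter, hB, mem_nonMemberSubfamily, mem_insert]
          intro h
          refine ⟨⟨h.1.1, h.2⟩, h.1.2.1, h.1.2.2, ?_⟩
          rintro (h' | h')
          · exact hia h'.symm
          · exact h.2 h'
        · refine card_le_card_of_injOn (fun v => v.erase a) ?_ ?_
          · intro v hv
            simp only [coe_filter, mem_filter, Set.mem_ofPred_eq, not_not] at hv
            have e : insert a (insert i (v.erase a)) = insert i v := by
              rw [Finset.insert_comm, insert_erase hv.2]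
            simp only [coe_filter, Set.mem_ofPred_eq, hD, mem_memberSubfamily, e,
              insert_erase hv.2]
            refine ⟨⟨hv.1.1, by simp⟩, fun h => hv.1.2.1 (mem_of_mem_erase h), hv.1.2.2, ?_⟩
            simp [hia.symm]
          · intro v hv w hw h
            simp only [coe_filter, mem_filter, Set.mem_ofPred_eq, not_not] at hv hw h
            rw [← insert_erase hv.2, ← insert_erase hw.2, h]
      refine e1.trans ?_
      rw [← card_union_add_card_inter]
      refine Nat.add_le_add (card_le_card fun v => ?_) (card_le_card fun v => ?_)
      · simp only [mem_union, mem_filter]; tauto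
      · simp only [mem_inter, mem_filter]; tauto
    rw [sum_insert ha, h1]
    have h3 := (Finset.sum_le_sum h2).trans_eq Finset.sum_add_distrib
    have h4 := ih (B ∪ D) d (fun v hv => (mem_union.1 hv).elim (hBs v) (hDs v)) hBD
    have h5 : ∑ i ∈ s, #{v ∈ B ∩ D | i ∉ v ∧ insert i v ∈ B ∩ D} + #(B ∩ D) ≤ d * #(B ∩ D) := by
      rcases (B ∩ D).eq_empty_or_nonempty with h0 | h0
      · simp [h0]
      · have hd1 : 1 ≤ d := by
          have := hcap ∅ (shatters_empty.2 h0)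
          simpa using this
        have := ih (B ∩ D) (d - 1) (fun v hv => hBs v (mem_inter.1 hv).1)
          (fun t ht => Nat.le_sub_of_add_le (hcap t ht))
        obtain ⟨e, rfl⟩ := Nat.exists_eq_add_of_le' hd1
        rw [Nat.add_sub_cancel] at this
        linarith
    have h6 : #𝒜 = #(B ∪ D) + #(B ∩ D) := by
      rw [card_union_add_card_inter, add_comm,
        ← card_memberSubfamily_add_card_nonMemberSubfamily a 𝒜]
    rw [h6]
    linarith

/-- Weighted form of `card_hypercube_edges_le`. -/
theorem sum_min_hypercube_edges_le {ι : Type*} [Fintype ι] [DecidableEq ι] (c : Finset ι → ℕ)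
    (d : ℕ) (hd : ∀ t, ({v | 0 < c v} : Finset (Finset ι)).Shatters t → #t ≤ d) :
    ∑ i, ∑ v with i ∉ v, min (c v) (c (insert i v)) ≤ d * ∑ v, c v := by
  set M := ∑ v, c v with hM
  have hcM : ∀ v, c v ≤ M := fun v => single_le_sum (fun _ _ => Nat.zero_le _) (mem_univ v)
  -- Layer-cake decomposition: the unweighted bound applies to each superlevel set of `c`, all of
  -- which lie in the support.
  have layer : ∀ a ≤ M, a = ∑ t ∈ range M, if t < a then 1 else 0 := by
    intro a ha
    rw [← card_filter]
    have : (range M).filter (· < a) = range a := by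
      ext t; simp only [mem_filter, mem_range]; omega
    rw [this, card_range]
  have key : ∀ t ∈ range M, ∑ i, #{v ∈ ({v | t < c v} : Finset (Finset ι)) |
      i ∉ v ∧ insert i v ∈ ({v | t < c v} : Finset (Finset ι))} ≤ d * #{v | t < c v} := by
    intro t _
    refine card_hypercube_edges_le univ _ d (fun v _ => subset_univ v) fun r hr => hd r ?_
    exact hr.mono_left fun v => by simp only [mem_filter, mem_univ, true_and]; omega
  calc ∑ i, ∑ v with i ∉ v, min (c v) (c (insert i v))
      = ∑ i, ∑ v with i ∉ v, ∑ t ∈ range M, if t < min (c v) (c (insert i v)) then 1 else 0 := by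
        refine sum_congr rfl fun i _ => sum_congr rfl fun v _ => layer _ ?_
        exact (min_le_left _ _).trans (hcM v)
    _ = ∑ t ∈ range M, ∑ i, #{v ∈ ({v | t < c v} : Finset (Finset ι)) |
          i ∉ v ∧ insert i v ∈ ({v | t < c v} : Finset (Finset ι))} := by
        rw [sum_congr rfl fun i _ => sum_comm, sum_comm]
        refine sum_congr rfl fun t _ => sum_congr rfl fun i _ => ?_
        rw [← card_filter]
        congr 1
        ext v
        simp only [mem_filter, mem_univ, true_and, lt_min_iff]
        tauto
    _ ≤ ∑ t ∈ range M, d * #{v | t < c v} := sum_le_sum key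
    _ = d * M := by
        rw [← mul_sum, hM]
        congr 1
        simp_rw [card_filter]
        rw [sum_comm]
        exact sum_congr rfl fun v _ => (layer _ (hcM v)).symm

/-! ### Independent samples and separated families -/

section Sampling

variable {X ι : Type*} [Fintype X] [DecidableEq X] [Fintype ι] [DecidableEq ι]

/-- The weight of a tuple of independent samples. -/
def sampleWeight (w : X → ℝ) (y : ι → X) : ℝ := ∏ i, w (y i)

theorem sampleWeight_nonneg {w : X → ℝ} (hw : ∀ x, 0 ≤ w x) (y : ι → X) :
    0 ≤ sampleWeight w y := prod_nonneg fun _ _ => hw _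

theorem sum_sampleWeight {w : X → ℝ} (hw1 : ∑ x, w x = 1) :
    ∑ y : ι → X, sampleWeight w y = 1 := by
  simp only [sampleWeight]
  rw [← Fintype.piFinset_univ, ← prod_univ_sum]
  simp [hw1]

/-- Resampling one coordinate does not change expectations. -/
theorem sum_sampleWeight_update {w : X → ℝ} (hw1 : ∑ x, w x = 1) (i : ι) (F : (ι → X) → ℝ) :
    ∑ y, sampleWeight w y * ∑ x, w x * F (Function.update y i x) =
      ∑ y, sampleWeight w y * F y := by
  have e1 : ∑ y, sampleWeight w y * F y =
      ∑ p : (ι → X) × X, sampleWeight w p.1 * w p.2 * F p.1 := by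
    rw [Fintype.sum_prod_type]
    refine sum_congr rfl fun y _ => ?_
    simp only
    rw [← sum_mul, ← mul_sum, hw1, mul_one]
  have e2 : ∑ y, sampleWeight w y * ∑ x, w x * F (Function.update y i x) =
      ∑ p : (ι → X) × X, sampleWeight w p.1 * w p.2 * F (Function.update p.1 i p.2) := by
    rw [Fintype.sum_prod_type]
    refine sum_congr rfl fun y _ => ?_
    rw [mul_sum]
    exact sum_congr rfl fun x _ => by ring
  rw [e1, e2]
  -- Exchanging coordinate `i` with the fresh point is an involution preserving the product weight.
  let φ : (ι → X) × X → (ι → X) × X := fun p => (Function.update p.1 i p.2, p.1 i)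
  have hφ : Function.Involutive φ := fun p => by simp [φ]
  refine Fintype.sum_equiv hφ.toPerm _ _ fun p => ?_
  change _ = sampleWeight w (Function.update p.1 i p.2) * w (p.1 i) * _
  congr 1
  simp only [sampleWeight]
  have h : ∏ j ∈ univ.erase i, w (Function.update p.1 i p.2 j) = ∏ j ∈ univ.erase i, w (p.1 j) :=
    prod_congr rfl fun j hj => by rw [Function.update_of_ne (ne_of_mem_erase hj)]
  rw [← mul_prod_erase univ (fun j => w (p.1 j)) (mem_univ i),
    ← mul_prod_erase univ (fun j => w (Function.update p.1 i p.2 j)) (mem_univ i),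
    Function.update_self, h]
  ring

/-- The expectation of a function of one coordinate. -/
theorem sum_sampleWeight_apply {w : X → ℝ} (hw1 : ∑ x, w x = 1) (i : ι) (f : X → ℝ) :
    ∑ y : ι → X, sampleWeight w y * f (y i) = ∑ x, w x * f x := by
  rw [← sum_sampleWeight_update hw1 i]
  simp only [Function.update_self]
  rw [← sum_mul, sum_sampleWeight hw1, one_mul]

/-- Resampling the coordinates outside `T` does not change expectations. -/
theorem sum_sampleWeight_piecewise {w : X → ℝ} (hw1 : ∑ x, w x = 1) (T : Finset ι)
    (F : (ι → X) → ℝ) :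
    ∑ y, sampleWeight w y * ∑ z, sampleWeight w z * F (T.piecewise y z) =
      ∑ y, sampleWeight w y * F y := by
  have e1 : ∑ y, sampleWeight w y * F y =
      ∑ p : (ι → X) × (ι → X), sampleWeight w p.1 * sampleWeight w p.2 * F p.1 := by
    rw [Fintype.sum_prod_type]
    refine sum_congr rfl fun y _ => ?_
    simp only
    rw [← sum_mul, ← mul_sum, sum_sampleWeight hw1, mul_one]
  have e2 : ∑ y, sampleWeight w y * ∑ z, sampleWeight w z * F (T.piecewise y z) =
      ∑ p : (ι → X) × (ι → X),
        sampleWeight w p.1 * sampleWeight w p.2 * F (T.piecewise p.1 p.2) := by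
    rw [Fintype.sum_prod_type]
    refine sum_congr rfl fun y _ => ?_
    rw [mul_sum]
    exact sum_congr rfl fun x _ => by ring
  rw [e1, e2]
  let φ : (ι → X) × (ι → X) → (ι → X) × (ι → X) := fun p =>
    (T.piecewise p.1 p.2, T.piecewise p.2 p.1)
  have hφ : Function.Involutive φ := fun p => by
    ext j <;> by_cases hj : j ∈ T <;> simp [φ, hj]
  refine Fintype.sum_equiv hφ.toPerm _ _ fun p => ?_
  change _ = sampleWeight w (T.piecewise p.1 p.2) * sampleWeight w (T.piecewise p.2 p.1) * _
  congr 1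
  simp only [sampleWeight]
  rw [← prod_mul_distrib, ← prod_mul_distrib]
  refine prod_congr rfl fun j _ => ?_
  by_cases hj : j ∈ T <;> simp [hj, mul_comm]

/-- The trace of `A` on the tuple `y`. -/
def trace (y : ι → X) (A : Finset X) : Finset ι := {i | y i ∈ A}

@[simp] theorem mem_trace {y : ι → X} {A : Finset X} {i : ι} : i ∈ trace y A ↔ y i ∈ A := by
  simp [trace]

/-- Sets shattered by the traces on a tuple are no larger than the VC-dimension. -/
theorem card_le_vcDim_of_shatters_trace {𝓡 : Finset (Finset X)} (y : ι → X) {t : Finset ι}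
    (ht : (𝓡.image (trace y)).Shatters t) : #t ≤ 𝓡.vcDim := by
  have hinj : Set.InjOn y t := by
    intro i hi j hj hij
    obtain ⟨v, hv, hvi⟩ := ht.exists_inter_eq_singleton hi
    obtain ⟨A, hA, rfl⟩ := mem_image.1 hv
    have hiA : i ∈ t ∩ trace y A := by rw [hvi]; simp
    have : j ∈ t ∩ trace y A := by
      rw [mem_inter, mem_trace] at hiA ⊢
      exact ⟨hj, hij ▸ hiA.2⟩
    rw [hvi, mem_singleton] at this
    exact this.symm
  rw [← card_image_of_injOn hinj]
  refine Shatters.card_le_vcDim fun r hr => ?_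
  obtain ⟨v, hv, hvr⟩ := ht (filter_subset (fun i => y i ∈ r) t)
  obtain ⟨A, hA, rfl⟩ := mem_image.1 hv
  refine ⟨A, hA, ?_⟩
  ext x
  constructor
  · intro hx
    rw [mem_inter, mem_image] at hx
    obtain ⟨⟨i, hi, rfl⟩, hx⟩ := hx
    have : i ∈ t ∩ trace y A := by simp [hi, hx]
    rw [hvr, mem_filter] at this
    exact this.2
  · intro hx
    obtain ⟨i, hi, rfl⟩ := mem_image.1 (hr hx)
    have : i ∈ t ∩ trace y A := by rw [hvr, mem_filter]; exact ⟨hi, hx⟩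
    rw [mem_inter, mem_trace] at this
    exact mem_inter.2 ⟨mem_image_of_mem _ hi, this.2⟩

/-- If the members of `K` are pairwise `δ`-separated, a random point splits `K` evenly enough. -/
theorem le_sum_min_split {w : X → ℝ} (hw : ∀ x, 0 ≤ w x) {δ : ℝ} (K : Finset (Finset X))
    (hK : ∀ A ∈ K, ∀ B ∈ K, A ≠ B → δ ≤ ∑ x ∈ symmDiff A B, w x) (hne : K.Nonempty) :
    δ / 2 * ((#K : ℝ) - 1) ≤
      ∑ x, w x * (min #{A ∈ K | x ∉ A} #{A ∈ K | x ∈ A} : ℕ) := by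
  have hk : (0 : ℝ) < #K := by exact_mod_cast hne.card_pos
  have hsum : ∑ x, w x * ((#{A ∈ K | x ∈ A} : ℝ) * #{A ∈ K | x ∉ A}) =
      ∑ A ∈ K, ∑ B ∈ K, ∑ x ∈ A \ B, w x := by
    have : ∀ x, w x * ((#{A ∈ K | x ∈ A} : ℝ) * #{A ∈ K | x ∉ A}) =
        ∑ A ∈ K, ∑ B ∈ K, if x ∈ A \ B then w x else 0 := by
      intro x
      rw [card_filter, card_filter]
      push_cast
      rw [sum_mul_sum, mul_sum]
      refine sum_congr rfl fun A _ => ?_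
      rw [mul_sum]
      refine sum_congr rfl fun B _ => ?_
      by_cases h1 : x ∈ A <;> by_cases h2 : x ∈ B <;> simp [h1, h2]
    simp_rw [this]
    rw [sum_comm]
    refine sum_congr rfl fun A _ => ?_
    rw [sum_comm]
    refine sum_congr rfl fun B _ => ?_
    rw [← sum_filter]
    congr 1
    ext x; simp
  have hlow : δ * (#K * ((#K : ℝ) - 1)) ≤ 2 * ∑ A ∈ K, ∑ B ∈ K, ∑ x ∈ A \ B, w x := by
    have e : 2 * ∑ A ∈ K, ∑ B ∈ K, ∑ x ∈ A \ B, w x =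
        ∑ A ∈ K, ∑ B ∈ K, ∑ x ∈ symmDiff A B, w x := by
      rw [two_mul]
      nth_rewrite 2 [sum_comm]
      rw [← sum_add_distrib]
      refine sum_congr rfl fun A _ => ?_
      rw [← sum_add_distrib]
      refine sum_congr rfl fun B _ => ?_
      rw [symmDiff_def, sup_eq_union, sum_union]
      exact disjoint_sdiff_sdiff
    rw [e]
    have : ∀ A ∈ K, δ * ((#K : ℝ) - 1) ≤ ∑ B ∈ K, ∑ x ∈ symmDiff A B, w x := by
      intro A hA
      rw [← add_sum_erase K _ hA]
      have h2 := card_nsmul_le_sum (K.erase A) (fun B => ∑ x ∈ symmDiff A B, w x) δ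
        fun B hB => hK A hA B (mem_of_mem_erase hB) (ne_of_mem_erase hB).symm
      rw [card_erase_of_mem hA, nsmul_eq_mul, Nat.cast_pred hne.card_pos] at h2
      simp only [symmDiff_self, bot_eq_empty, sum_empty, zero_add]
      linarith
    have h3 := card_nsmul_le_sum K _ _ this
    rw [nsmul_eq_mul] at h3
    linarith
  -- With a members containing `x` and b missing it, min(a, b) ≥ ab/(a + b); this turns the
  -- quadratic count of separated pairs into a linear bound.
  have hmin : ∀ x, (#{A ∈ K | x ∈ A} : ℝ) * #{A ∈ K | x ∉ A} / #K ≤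
      (min #{A ∈ K | x ∉ A} #{A ∈ K | x ∈ A} : ℕ) := by
    intro x
    rw [div_le_iff₀ hk]
    have hadd := card_filter_add_card_filter_not (s := K) (fun A => x ∈ A)
    have h : #{A ∈ K | x ∈ A} * #{A ∈ K | x ∉ A} ≤
        min #{A ∈ K | x ∉ A} #{A ∈ K | x ∈ A} * #K := by
      rcases le_total #{A ∈ K | x ∉ A} #{A ∈ K | x ∈ A} with h | h
      · rw [min_eq_left h, mul_comm]
        exact Nat.mul_le_mul_left _ (card_filter_le _ _)
      · rw [min_eq_right h]
        exact Nat.mul_le_mul_left _ (card_filter_le _ _)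
    exact_mod_cast h
  calc δ / 2 * ((#K : ℝ) - 1) = δ * (#K * ((#K : ℝ) - 1)) / (2 * #K) := by field_simp
    _ ≤ (2 * ∑ A ∈ K, ∑ B ∈ K, ∑ x ∈ A \ B, w x) / (2 * #K) := by gcongr
    _ = ∑ x, w x * ((#{A ∈ K | x ∈ A} : ℝ) * #{A ∈ K | x ∉ A} / #K) := by
        rw [← hsum, mul_div_mul_left _ _ two_ne_zero, sum_div]
        exact sum_congr rfl fun x _ => by ring
    _ ≤ _ := sum_le_sum fun x _ => mul_le_mul_of_nonneg_left (hmin x) (hw x)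

end Sampling

/-! ### Shallow traces and packing -/

/-- The traces of `𝓡` with at most `k` elements on a finite set `Y` number at most
`C k * (#Y + 1)`. -/
def ShallowBound {X : Type*} [DecidableEq X] (C : ℕ → ℕ) (𝓡 : Finset (Finset X)) : Prop :=
  ∀ (k : ℕ) (Y : Finset X), #{v ∈ 𝓡.image (· ∩ Y) | #v ≤ k} ≤ C k * (#Y + 1)

section Packing

variable {X ι : Type*} [Fintype X] [DecidableEq X] [Fintype ι] [DecidableEq ι]

/-- Haussler's inequality: on a large sample, a `δ`-separated family has many traces. -/
theorem mul_card_sub_expected_traces_le {w : X → ℝ} (hw : ∀ x, 0 ≤ w x) (hw1 : ∑ x, w x = 1)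
    {δ : ℝ} (hδ : 0 ≤ δ) {𝓡 𝓠 : Finset (Finset X)} (h𝓠 : 𝓠 ⊆ 𝓡)
    (hsep : ∀ A ∈ 𝓠, ∀ B ∈ 𝓠, A ≠ B → δ ≤ ∑ x ∈ symmDiff A B, w x) :
    Fintype.card ι * (δ / 2) *
        ((#𝓠 : ℝ) - ∑ y : ι → X, sampleWeight w y * #(𝓠.image (trace y))) ≤
      𝓡.vcDim * #𝓠 := by
  -- Each trace is weighted by the number of members of `𝓠` having it. The total edge weight is
  -- bounded above for every sample by the VC-dimension. It is bounded below on average: with all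
  -- coordinates but `i` fixed, members that agree on those coordinates are split by resampling the
  -- `i`-th.
  let c : (ι → X) → Finset ι → ℕ := fun y v => #{A ∈ 𝓠 | trace y A = v}
  let Z : (ι → X) → ι → ℕ := fun y i => ∑ v with i ∉ v, min (c y v) (c y (insert i v))
  have upper : ∀ y, ∑ i, Z y i ≤ 𝓡.vcDim * #𝓠 := by
    intro y
    have hc : ∑ v, c y v = #𝓠 :=
      (card_eq_sum_card_fiberwise (f := trace y) (t := univ) fun _ _ => by simp).symm
    rw [← hc]
    refine sum_min_hypercube_edges_le (c y) _ fun t ht => ?_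
    refine card_le_vcDim_of_shatters_trace y (ht.mono_left fun v hv => ?_)
    obtain ⟨A, hA⟩ := card_pos.1 (mem_filter.1 hv).2
    rw [mem_filter] at hA
    exact mem_image.2 ⟨A, h𝓠 hA.1, hA.2⟩
  have lower : ∀ i y, δ / 2 * ((#𝓠 : ℝ) - #(𝓠.image (trace y))) ≤
      ∑ x, w x * Z (Function.update y i x) i := by
    intro i y
    let K : Finset ι → Finset (Finset X) := fun v => {A ∈ 𝓠 | (trace y A).erase i = v}
    let I := 𝓠.image fun A => (trace y A).erase i
    have hIcard : #I ≤ #(𝓠.image (trace y)) := by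
      have : I = (𝓠.image (trace y)).image fun v => v.erase i := by
        rw [image_image]; rfl
      rw [this]
      exact card_image_le
    have hIi : I ⊆ ({v | i ∉ v} : Finset (Finset ι)) := by
      intro v hv
      obtain ⟨A, _, rfl⟩ := mem_image.1 hv
      simp
    have hc0 : ∀ x v, i ∉ v → c (Function.update y i x) v = #{A ∈ K v | x ∉ A} := by
      intro x v hv
      simp only [c, K, filter_filter]
      congr 1
      refine filter_congr fun A _ => ?_
      constructor
      · rintro rfl
        refine ⟨?_, by simpa using hv⟩
        ext j
        rcases eq_or_ne j i with rfl | hj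
        · simpa using hv
        · simp [hj]
      · rintro ⟨rfl, hx⟩
        ext j
        rcases eq_or_ne j i with rfl | hj
        · simpa using hx
        · simp [hj]
    have hc1 : ∀ x v, i ∉ v → c (Function.update y i x) (insert i v) = #{A ∈ K v | x ∈ A} := by
      intro x v hv
      simp only [c, K, filter_filter]
      congr 1
      refine filter_congr fun A _ => ?_
      constructor
      · intro h
        constructor
        · ext j
          have := congrArg (j ∈ ·) h
          rcases eq_or_ne j i with rfl | hj
          · simpa using hv
          · simpa [hj] using this
        · have := congrArg (i ∈ ·) h
          simpa using this
      · rintro ⟨rfl, hx⟩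
        ext j
        rcases eq_or_ne j i with rfl | hj
        · simpa using hx
        · simp [hj]
    have hfib : (#𝓠 : ℝ) = ∑ v ∈ I, (#(K v) : ℝ) := by
      have := card_eq_sum_card_fiberwise (s := 𝓠) (t := I) (f := fun A => (trace y A).erase i)
        fun A hA => mem_image_of_mem _ hA
      exact_mod_cast this
    calc δ / 2 * ((#𝓠 : ℝ) - #(𝓠.image (trace y))) ≤ δ / 2 * ((#𝓠 : ℝ) - #I) := by gcongr
      _ = ∑ v ∈ I, δ / 2 * ((#(K v) : ℝ) - 1) := by
        rw [← mul_sum, sum_sub_distrib, ← hfib]; simp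
      _ ≤ ∑ v ∈ I, ∑ x, w x * (min #{A ∈ K v | x ∉ A} #{A ∈ K v | x ∈ A} : ℕ) := by
        refine sum_le_sum fun v hv => le_sum_min_split hw _ ?_ ?_
        · intro A hA B hB
          exact hsep A (mem_filter.1 hA).1 B (mem_filter.1 hB).1
        · obtain ⟨A, hA, hAv⟩ := mem_image.1 hv
          exact ⟨A, mem_filter.2 ⟨hA, hAv⟩⟩
      _ ≤ ∑ v with i ∉ v, ∑ x, w x * (min #{A ∈ K v | x ∉ A} #{A ∈ K v | x ∈ A} : ℕ) :=
        sum_le_sum_of_subset_of_nonneg hIi fun v _ _ =>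
          sum_nonneg fun x _ => mul_nonneg (hw x) (Nat.cast_nonneg _)
      _ = ∑ x, w x * Z (Function.update y i x) i := by
        rw [sum_comm]
        refine sum_congr rfl fun x _ => ?_
        rw [← mul_sum]
        congr 1
        simp only [Z]
        rw [Nat.cast_sum]
        refine sum_congr rfl fun v hv => ?_
        rw [hc0 x v (mem_filter.1 hv).2, hc1 x v (mem_filter.1 hv).2]
  have hW := fun y : ι → X => sampleWeight_nonneg hw y
  have hW1 := sum_sampleWeight (ι := ι) hw1
  have expect : ∀ i, δ / 2 * ((#𝓠 : ℝ) - ∑ y : ι → X, sampleWeight w y * #(𝓠.image (trace y))) ≤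
      ∑ y, sampleWeight w y * (Z y i : ℝ) := by
    intro i
    rw [← sum_sampleWeight_update hw1 i fun y => (Z y i : ℝ)]
    calc _ = ∑ y : ι → X, sampleWeight w y * (δ / 2 * ((#𝓠 : ℝ) - #(𝓠.image (trace y)))) := by
          have : (#𝓠 : ℝ) = ∑ y : ι → X, sampleWeight w y * #𝓠 := by
            rw [← sum_mul, hW1, one_mul]
          rw [this, ← sum_sub_distrib, mul_sum]
          simp_rw [← this]
          exact sum_congr rfl fun y _ => by ring
      _ ≤ _ := sum_le_sum fun y _ => mul_le_mul_of_nonneg_left (lower i y) (hW y)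
  calc _ = ∑ _i : ι, δ / 2 *
          ((#𝓠 : ℝ) - ∑ y : ι → X, sampleWeight w y * #(𝓠.image (trace y))) := by
        rw [sum_const, card_univ, nsmul_eq_mul, mul_assoc]
    _ ≤ ∑ i, ∑ y, sampleWeight w y * (Z y i : ℝ) := sum_le_sum fun i _ => expect i
    _ = ∑ y, sampleWeight w y * ((∑ i, Z y i : ℕ) : ℝ) := by
        rw [sum_comm]
        exact sum_congr rfl fun y _ => by rw [← mul_sum, Nat.cast_sum]
    _ ≤ ∑ y : ι → X, sampleWeight w y * ((𝓡.vcDim * #𝓠 : ℕ) : ℝ) :=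
        sum_le_sum fun y _ => mul_le_mul_of_nonneg_left (by exact_mod_cast upper y) (hW y)
    _ = 𝓡.vcDim * #𝓠 := by rw [← sum_mul, hW1, one_mul]; push_cast; ring

/-- The shallow traces on a tuple. -/
theorem ShallowBound.card_filter_image_trace_le {C : ℕ → ℕ} {𝓡 : Finset (Finset X)}
    (hC : ShallowBound C 𝓡) (k : ℕ) (y : ι → X) :
    #{v ∈ 𝓡.image (trace y) | #v ≤ k} ≤ C k * (Fintype.card ι + 1) := by
  have hY : #(univ.image y) ≤ Fintype.card ι := card_image_le
  refine le_trans ?_ ((hC k (univ.image y)).trans (by gcongr))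
  have himg : ∀ A : Finset X, (trace y A).image y = A ∩ univ.image y := by
    intro A
    ext x
    simp only [mem_image, mem_trace, mem_inter, mem_univ, true_and]
    constructor
    · rintro ⟨i, hi, rfl⟩; exact ⟨hi, i, rfl⟩
    · rintro ⟨hx, i, rfl⟩; exact ⟨i, hx, rfl⟩
  refine card_le_card_of_injOn (fun v => v.image y) ?_ ?_
  · intro v hv
    rw [mem_coe, mem_filter, mem_image] at hv
    obtain ⟨⟨A, hA, rfl⟩, hk⟩ := hv
    rw [mem_coe, mem_filter]
    exact ⟨mem_image.2 ⟨A, hA, (himg A).symm⟩, card_image_le.trans hk⟩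
  · have hinv : ∀ v ∈ 𝓡.image (trace y), trace y (v.image y) = v := by
      intro v hv
      obtain ⟨A, hA, rfl⟩ := mem_image.1 hv
      rw [himg]
      ext i
      simp
    intro v hv v' hv' h
    rw [mem_coe, mem_filter] at hv hv'
    rw [← hinv v hv.1, ← hinv v' hv'.1]
    exact congrArg _ h

/-- A linear packing bound. -/
theorem ShallowBound.card_le_of_separated {C : ℕ → ℕ} {𝓡 𝓠 : Finset (Finset X)}
    (hC : ShallowBound C 𝓡) {d : ℕ} (hd : 1 ≤ d) (hvc : 𝓡.vcDim ≤ d)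
    {w : X → ℝ} (hw : ∀ x, 0 ≤ w x) (hw1 : ∑ x, w x = 1)
    {δ ρ : ℝ} (hδ : 0 < δ) (hρ : 0 ≤ ρ) (h𝓠 : 𝓠 ⊆ 𝓡)
    (hsep : ∀ A ∈ 𝓠, ∀ B ∈ 𝓠, A ≠ B → δ ≤ ∑ x ∈ symmDiff A B, w x)
    (hsmall : ∀ A ∈ 𝓠, ∑ x ∈ A, w x ≤ ρ * δ) {k : ℕ} (hk : 4 * (4 * d * ρ + 1) ≤ (k : ℝ) + 1) :
    (#𝓠 : ℝ) ≤ 4 * C k * (4 * d / δ + 2) := by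
  -- As nδ ≥ 4d, Haussler's inequality gives 2d(#𝓠 − E) ≤ d #𝓠 for the expected number E of traces,
  -- that is, #𝓠 ≤ 2E.
  set n := ⌈4 * d / δ⌉₊ with hn
  have hd0 : (0 : ℝ) < d := by exact_mod_cast hd
  have hn1 : 4 * d / δ ≤ n := Nat.le_ceil _
  have hn2 : (n : ℝ) ≤ 4 * d / δ + 1 := (Nat.ceil_lt_add_one (by positivity)).le
  have hnδ : 4 * d ≤ n * δ := by rwa [div_le_iff₀ hδ] at hn1
  set N : (Fin n → X) → ℝ := fun y => #(𝓠.image (trace y)) with hN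
  have hW := fun y : Fin n → X => sampleWeight_nonneg hw y
  have hW1 := sum_sampleWeight (ι := Fin n) hw1
  have haus := mul_card_sub_expected_traces_le (ι := Fin n) hw hw1 hδ.le h𝓠 hsep
  rw [Fintype.card_fin] at haus
  have hA1 : ∀ A ∈ 𝓠, n * ∑ x ∈ A, w x ≤ 4 * d * ρ + 1 := by
    intro A hA
    have h1 : ∑ x ∈ A, w x ≤ 1 := by
      rw [← hw1]; exact sum_le_sum_of_subset_of_nonneg (subset_univ A) fun x _ _ => hw x
    have h0 : 0 ≤ ∑ x ∈ A, w x := sum_nonneg fun x _ => hw x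
    calc n * ∑ x ∈ A, w x ≤ (4 * d / δ + 1) * ∑ x ∈ A, w x := by gcongr
      _ = 4 * d / δ * ∑ x ∈ A, w x + ∑ x ∈ A, w x := by ring
      _ ≤ 4 * d / δ * (ρ * δ) + 1 := by gcongr; exact hsmall A hA
      _ = _ := by field_simp
  -- Traces of more than `k` points are counted by Markov's inequality, the others by the shallow
  -- bound. The choice of `k` makes the first part at most #𝓠/4 in expectation, which is absorbed in
  -- #𝓠 ≤ 2E.
  have hNy : ∀ y, N y ≤ ∑ A ∈ 𝓠, (∑ i, if y i ∈ A then (1 : ℝ) else 0) / (k + 1) +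
      C k * (n + 1) := by
    intro y
    have h1 : #(𝓠.image (trace y)) ≤ #{A ∈ 𝓠 | k + 1 ≤ #(trace y A)} + C k * (n + 1) := by
      have hb := hC.card_filter_image_trace_le k y
      rw [Fintype.card_fin] at hb
      refine le_trans ?_ (Nat.add_le_add (card_image_le (f := trace y)) hb)
      refine (card_le_card fun v hv => ?_).trans (card_union_le _ _)
      obtain ⟨A, hA, rfl⟩ := mem_image.1 hv
      rw [mem_union]
      by_cases h : k + 1 ≤ #(trace y A)
      · exact Or.inl (mem_image_of_mem _ (mem_filter.2 ⟨hA, h⟩))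
      · exact Or.inr (mem_filter.2 ⟨mem_image_of_mem _ (h𝓠 hA), by omega⟩)
    have h2 : (#{A ∈ 𝓠 | k + 1 ≤ #(trace y A)} : ℝ) ≤
        ∑ A ∈ 𝓠, (∑ i, if y i ∈ A then (1 : ℝ) else 0) / (k + 1) := by
      rw [card_filter]
      push_cast
      refine sum_le_sum fun A _ => ?_
      have e : (∑ i, if y i ∈ A then (1 : ℝ) else 0) = #(trace y A) := by
        rw [trace, card_filter]; push_cast; rfl
      rw [e]
      split_ifs with h
      · rw [le_div_iff₀ (by positivity), one_mul]; exact_mod_cast h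
      · positivity
    have h1' : N y ≤ (#{A ∈ 𝓠 | k + 1 ≤ #(trace y A)} : ℝ) + C k * (n + 1) := by
      simp only [hN]; exact_mod_cast h1
    linarith
  have hE : ∑ y, sampleWeight w y * N y ≤ #𝓠 / 4 + C k * (n + 1) := by
    calc ∑ y, sampleWeight w y * N y
        ≤ ∑ y, sampleWeight w y * (∑ A ∈ 𝓠, (∑ i, if y i ∈ A then (1 : ℝ) else 0) / (k + 1) +
          C k * (n + 1)) := sum_le_sum fun y _ => mul_le_mul_of_nonneg_left (hNy y) (hW y)
      _ = ∑ A ∈ 𝓠, (n * ∑ x ∈ A, w x) / (k + 1) + C k * (n + 1) := by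
        rw [sum_congr rfl fun y _ => mul_add _ _ _, sum_add_distrib, ← sum_mul, hW1, one_mul]
        congr 1
        simp_rw [mul_sum]
        rw [sum_comm]
        refine sum_congr rfl fun A _ => ?_
        simp_rw [sum_div, mul_sum]
        rw [sum_comm]
        have : ∀ i : Fin n, ∑ y : Fin n → X,
            sampleWeight w y * ((if y i ∈ A then (1 : ℝ) else 0) / (k + 1)) =
            (∑ x ∈ A, w x) / (k + 1) := by
          intro i
          rw [sum_sampleWeight_apply hw1 i fun x => (if x ∈ A then (1 : ℝ) else 0) / (k + 1)]
          rw [sum_div, ← sum_filter_add_sum_filter_not univ (· ∈ A)]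
          rw [sum_congr rfl fun x hx => by rw [if_pos (mem_filter.1 hx).2],
            sum_congr (g := fun _ => (0 : ℝ)) (s₁ := univ.filter (· ∉ A)) rfl fun x hx => by
              rw [if_neg (mem_filter.1 hx).2]; simp]
          simp [div_eq_mul_inv]
        rw [sum_congr rfl fun i _ => this i]
        simp [mul_sum, sum_div, mul_div_assoc]
      _ ≤ ∑ A ∈ 𝓠, (1 / 4 : ℝ) + C k * (n + 1) := by
        refine add_le_add (sum_le_sum fun A hA => ?_) le_rfl
        rw [div_le_iff₀ (by positivity)]
        have := hA1 A hA
        linarith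
      _ = _ := by rw [sum_const, nsmul_eq_mul]; ring
  set E := ∑ y, sampleWeight w y * N y with hEdef
  have h2E : (#𝓠 : ℝ) ≤ 2 * E := by
    have hE0 : 0 ≤ E := sum_nonneg fun y _ => mul_nonneg (hW y) (Nat.cast_nonneg _)
    by_contra hlt
    push Not at hlt
    have hpos : 0 < (#𝓠 : ℝ) - E := by linarith
    have h1 : 2 * d * ((#𝓠 : ℝ) - E) ≤ n * (δ / 2) * ((#𝓠 : ℝ) - E) :=
      mul_le_mul_of_nonneg_right (by linarith) hpos.le
    have h2 : (𝓡.vcDim : ℝ) * #𝓠 ≤ d * #𝓠 := by gcongr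
    have h3 : d * (2 * ((#𝓠 : ℝ) - E)) ≤ d * #𝓠 := by linarith
    have := le_of_mul_le_mul_left h3 hd0
    linarith
  have : (#𝓠 : ℝ) ≤ 4 * (C k * (n + 1)) := by linarith
  refine this.trans ?_
  rw [← mul_assoc]
  exact mul_le_mul_of_nonneg_left (by linarith) (by positivity)

end Packing

/-! ### Nets of constant size by double sampling -/

theorem sauer_bound {α : Type*} [Fintype α] [DecidableEq α] (F : Finset (Finset α)) {d : ℕ}
    (hF : F.vcDim ≤ d) : #F ≤ ∑ k ∈ Iic d, (Fintype.card α).choose k :=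
  (card_le_card_shatterer F).trans <| card_shatterer_le_sum_vcDim.trans <|
    sum_le_sum_of_subset (Iic_subset_Iic.2 hF)

/-- The central binomial coefficient eventually exceeds the Sauer bound. -/
theorem exists_two_mul_sauer_lt_choose (d : ℕ) :
    ∃ t : ℕ, 0 < t ∧ 2 * ∑ k ∈ Iic d, (2 * t).choose k < (2 * t).choose t := by
  have h := (tendsto_pow_const_div_const_pow_of_one_lt (d + 1) (r := (4 : ℝ))
    (by norm_num)).const_mul (2 * (d + 1) * 2 ^ d : ℝ)
  rw [mul_zero] at h
  obtain ⟨t, ht, ht4⟩ := ((h.eventually_lt_const one_pos).and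
    (Filter.eventually_ge_atTop 4)).exists
  refine ⟨t, by omega, ?_⟩
  rw [← mul_div_assoc, div_lt_one (by positivity)] at ht
  have h1 : t * (2 * ((d + 1) * (2 * t) ^ d)) < t * (2 * t).choose t := by
    have := Nat.four_pow_lt_mul_centralBinom t ht4
    rw [Nat.centralBinom_eq_two_mul_choose] at this
    refine lt_of_le_of_lt ?_ this
    have : 2 * (d + 1) * 2 ^ d * t ^ (d + 1) < 4 ^ t := by exact_mod_cast ht
    refine le_trans (le_of_eq ?_) this.le
    rw [mul_pow, pow_succ t d]
    ring
  refine lt_of_le_of_lt ?_ (lt_of_mul_lt_mul_left h1 (Nat.zero_le t))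
  refine Nat.mul_le_mul_left 2 ?_
  calc ∑ k ∈ Iic d, (2 * t).choose k ≤ ∑ k ∈ Iic d, (2 * t) ^ d := by
        refine sum_le_sum fun k hk => (Nat.choose_le_pow (2 * t) k).trans ?_
        exact Nat.pow_le_pow_right (by omega) (mem_Iic.1 hk)
    _ = (d + 1) * (2 * t) ^ d := by rw [sum_const, Nat.card_Iic, smul_eq_mul]

/-- A range space of bounded VC-dimension has a net of bounded size for the ranges of almost full
measure. -/
theorem exists_small_net {X : Type*} [Fintype X] [DecidableEq X] {d t : ℕ} (ht0 : 0 < t)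
    (ht : 2 * ∑ k ∈ Iic d, (2 * t).choose k < (2 * t).choose t)
    {w : X → ℝ} (hw : ∀ x, 0 ≤ w x) (hw1 : ∑ x, w x = 1)
    {𝓡 : Finset (Finset X)} (hvc : 𝓡.vcDim ≤ d) :
    ∃ S : Finset X, #S ≤ t ∧ (∀ x ∈ S, 0 < w x) ∧
      ∀ R ∈ 𝓡, 1 - 1 / (2 * t : ℝ) ≤ ∑ x ∈ R, w x → ∃ x ∈ S, x ∈ R := by
  by_contra hcon
  have hcon' : ∀ S : Finset X, ∃ R : Finset X, #S ≤ t → (∀ x ∈ S, 0 < w x) →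
      R ∈ 𝓡 ∧ 1 - 1 / (2 * t : ℝ) ≤ ∑ x ∈ R, w x ∧ ∀ x ∈ S, x ∉ R := by
    intro S
    by_cases h : #S ≤ t ∧ ∀ x ∈ S, 0 < w x
    · by_contra h2
      push Not at h2
      refine hcon ⟨S, h.1, h.2, fun R hR hRw => ?_⟩
      obtain ⟨-, -, h3⟩ := h2 R
      obtain ⟨x, hx, hxR⟩ := h3 hR hRw
      exact ⟨x, hx, hxR⟩
    · exact ⟨∅, fun h1 h2 => absurd ⟨h1, h2⟩ h⟩
  choose R hR using hcon'
  let ι := Fin (2 * t)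
  have hW := fun y : ι → X => sampleWeight_nonneg hw y
  have hW1 := sum_sampleWeight (ι := ι) hw1
  -- Fix the sample on `T`. The range missing those points contains all `t` remaining ones with
  -- probability at least 1 − t/(2t) = 1/2, and then its trace is exactly `Tᶜ`. Summing over `T`
  -- gives at least half of the central binomial coefficient many traces on average, against the
  -- Sauer bound.
  have key : ∀ T ∈ powersetCard t (univ : Finset ι), (1 / 2 : ℝ) ≤
      ∑ y : ι → X, sampleWeight w y * (if Tᶜ ∈ 𝓡.image (trace y) then 1 else 0) := by
    intro T hT
    rw [mem_powersetCard] at hT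
    have hTc : #Tᶜ = t := by
      rw [card_compl, hT.2, Fintype.card_fin]; omega
    rw [← sum_sampleWeight_piecewise hw1 T fun y =>
      (if Tᶜ ∈ 𝓡.image (trace y) then (1 : ℝ) else 0)]
    have hy : ∀ y : ι → X, sampleWeight w y * (1 / 2) ≤ sampleWeight w y * ∑ z : ι → X,
        sampleWeight w z * (if Tᶜ ∈ 𝓡.image (trace (T.piecewise y z)) then (1 : ℝ) else 0) := by
      intro y
      -- A sample of weight zero contributes nothing; otherwise its points have positive weight, as
      -- is required to apply `hR`.
      rcases (hW y).eq_or_lt with h0 | h0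
      · rw [← h0, zero_mul, zero_mul]
      refine mul_le_mul_of_nonneg_left ?_ (hW y)
      have hpos : ∀ x ∈ T.image y, 0 < w x := by
        intro x hx
        obtain ⟨i, -, rfl⟩ := mem_image.1 hx
        exact (hw _).lt_of_ne' (prod_ne_zero_iff.1 h0.ne' i (mem_univ i))
      obtain ⟨hR1, hR2, hR3⟩ := hR (T.image y) (card_image_le.trans hT.2.le) hpos
      set Q := R (T.image y)
      have hz : ∀ z : ι → X, 1 - ∑ j ∈ Tᶜ, (if z j ∈ Q then (0 : ℝ) else 1) ≤
          if Tᶜ ∈ 𝓡.image (trace (T.piecewise y z)) then (1 : ℝ) else 0 := by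
        intro z
        by_cases hall : ∀ j ∈ Tᶜ, z j ∈ Q
        · have : Tᶜ ∈ 𝓡.image (trace (T.piecewise y z)) := by
            refine mem_image.2 ⟨Q, hR1, ?_⟩
            ext j
            by_cases hj : j ∈ T
            · simpa [hj] using hR3 _ (mem_image_of_mem y hj)
            · simpa [hj] using hall j (mem_compl.2 hj)
          rw [if_pos this]
          have : 0 ≤ ∑ j ∈ Tᶜ, (if z j ∈ Q then (0 : ℝ) else 1) :=
            sum_nonneg fun j _ => by split_ifs <;> norm_num
          linarith
        · push Not at hall
          obtain ⟨j, hj, hjQ⟩ := hall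
          have h1 : (1 : ℝ) ≤ ∑ j ∈ Tᶜ, (if z j ∈ Q then (0 : ℝ) else 1) := by
            refine le_trans (by rw [if_neg hjQ]) (single_le_sum
              (f := fun j => if z j ∈ Q then (0 : ℝ) else 1) (fun j _ => ?_) hj)
            split_ifs <;> norm_num
          have h2 : (0 : ℝ) ≤ if Tᶜ ∈ 𝓡.image (trace (T.piecewise y z)) then 1 else 0 := by
            split_ifs <;> norm_num
          linarith
      have hQ : ∑ x, w x * (if x ∈ Q then (0 : ℝ) else 1) ≤ 1 / (2 * t : ℝ) := by
        have h1 : ∑ x, w x * (if x ∈ Q then (0 : ℝ) else 1) + ∑ x ∈ Q, w x = 1 := by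
          have h2 : ∑ x ∈ Q, w x = ∑ x, if x ∈ Q then w x else 0 := by simp
          rw [h2, ← sum_add_distrib]
          refine (sum_congr rfl fun x _ => ?_).trans hw1
          by_cases hx : x ∈ Q <;> simp [hx]
        linarith
      calc (1 / 2 : ℝ) = 1 - t * (1 / (2 * t : ℝ)) := by
            have : (t : ℝ) ≠ 0 := by exact_mod_cast ht0.ne'
            field_simp; norm_num
        _ ≤ 1 - t * ∑ x, w x * (if x ∈ Q then (0 : ℝ) else 1) := by gcongr
        _ = ∑ z : ι → X, sampleWeight w z *
            (1 - ∑ j ∈ Tᶜ, (if z j ∈ Q then (0 : ℝ) else 1)) := by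
            rw [sum_congr rfl fun z _ => mul_sub _ _ _, sum_sub_distrib]
            congr 1
            · simp [hW1]
            · rw [sum_congr rfl fun z _ => mul_sum _ _ _, sum_comm]
              rw [sum_congr rfl fun j _ =>
                sum_sampleWeight_apply hw1 j fun x => if x ∈ Q then (0 : ℝ) else 1]
              rw [sum_const, hTc, nsmul_eq_mul]
        _ ≤ _ := sum_le_sum fun z _ => mul_le_mul_of_nonneg_left (hz z) (hW z)
    calc (1 / 2 : ℝ) = ∑ y : ι → X, sampleWeight w y * (1 / 2) := by
          rw [← sum_mul, hW1, one_mul]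
      _ ≤ _ := sum_le_sum fun y _ => hy y
  have hsum := card_nsmul_le_sum _ _ _ key
  rw [card_powersetCard, card_univ, Fintype.card_fin, nsmul_eq_mul, sum_comm] at hsum
  have hle : ∀ y : ι → X, ∑ T ∈ powersetCard t (univ : Finset ι),
      sampleWeight w y * (if Tᶜ ∈ 𝓡.image (trace y) then (1 : ℝ) else 0) ≤
      sampleWeight w y * ((∑ k ∈ Iic d, (2 * t).choose k : ℕ) : ℝ) := by
    intro y
    rw [← mul_sum]
    refine mul_le_mul_of_nonneg_left ?_ (hW y)
    have h1 : #{T ∈ powersetCard t (univ : Finset ι) | Tᶜ ∈ 𝓡.image (trace y)} ≤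
        #(𝓡.image (trace y)) :=
      card_le_card_of_injOn compl (fun T hT => (mem_filter.1 hT).2) compl_injective.injOn
    have h2 := sauer_bound (𝓡.image (trace y)) (d := d)
      (Finset.sup_le fun s hs => (card_le_vcDim_of_shatters_trace y
        (mem_shatterer.1 hs)).trans hvc)
    rw [Fintype.card_fin] at h2
    rw [← Nat.cast_one, ← Nat.cast_zero]
    simp only [← Nat.cast_ite]
    rw [← Nat.cast_sum, ← card_filter]
    exact_mod_cast h1.trans h2
  have h3 := hsum.trans (sum_le_sum fun y _ => hle y)
  rw [← sum_mul, hW1, one_mul] at h3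
  have h4 : (2 * (∑ k ∈ Iic d, (2 * t).choose k : ℕ) : ℝ) < (2 * t).choose t := by
    exact_mod_cast ht
  linarith

/-- All pairs inside a shattered set are traces, so a shattered set of size m satisfies m(m − 1)/2 ≤
C 2 · (m + 1). -/
theorem ShallowBound.vcDim_le {X : Type*} [DecidableEq X] {C : ℕ → ℕ} {𝓡 : Finset (Finset X)}
    (hC : ShallowBound C 𝓡) : 𝓡.vcDim ≤ 4 * C 2 + 3 := by
  refine Finset.sup_le fun Y hY => ?_
  rw [mem_shatterer] at hY
  have h : #(powersetCard 2 Y) ≤ #{v ∈ 𝓡.image (· ∩ Y) | #v ≤ 2} := by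
    refine card_le_card fun v hv => ?_
    rw [mem_powersetCard] at hv
    obtain ⟨R, hR, hRv⟩ := hY hv.1
    exact mem_filter.2 ⟨mem_image.2 ⟨R, hR, by rw [← hRv, inter_comm]⟩, hv.2.le⟩
  have h2 := h.trans (hC 2 Y)
  rw [card_powersetCard, Nat.choose_two_right, Nat.div_le_iff_le_mul_add_pred two_pos] at h2
  by_contra hlt
  push Not at hlt
  obtain ⟨m, hm⟩ := Nat.exists_eq_add_of_lt hlt
  rw [hm] at h2
  simp only [Nat.add_one_sub_one, show 2 - 1 = 1 from rfl] at h2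
  nlinarith [Nat.zero_le m, Nat.zero_le (C 2), Nat.zero_le (m * C 2), Nat.zero_le (C 2 * C 2), Nat.zero_le (m * m)]

/-! ### Conditioning, packing numbers and the doubling constant -/

section Measure

variable {X : Type*} [Fintype X] [DecidableEq X] [MeasurableSpace X] [MeasurableSingletonClass X]

theorem measureReal_coe_finset (P : Measure X) [IsProbabilityMeasure P] (A : Finset X) :
    P.real (A : Set X) = ∑ x ∈ A, P.real {x} := (sum_measureReal_singleton A).symm

/-- The weights of `P` conditioned on `U`. -/
noncomputable def condWeight (P : Measure X) (U : Finset X) (x : X) : ℝ :=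
  if x ∈ U then P.real {x} / P.real (U : Set X) else 0

theorem condWeight_nonneg (P : Measure X) (U : Finset X) (x : X) : 0 ≤ condWeight P U x := by
  unfold condWeight; split_ifs <;> positivity

theorem sum_condWeight (P : Measure X) [IsProbabilityMeasure P] (U A : Finset X) :
    ∑ x ∈ A, condWeight P U x = P.real ((A ∩ U : Finset X) : Set X) / P.real (U : Set X) := by
  rw [measureReal_coe_finset P (A ∩ U), sum_div, ← filter_mem_eq_inter, sum_filter]
  rfl

theorem sum_univ_condWeight (P : Measure X) [IsProbabilityMeasure P] {U : Finset X}
    (hU : 0 < P.real (U : Set X)) : ∑ x, condWeight P U x = 1 := by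
  rw [sum_condWeight, univ_inter, div_self hU.ne']

end Measure

/-- The packing number of ranges of measure at most `2 r` in terms of the measure of their union. -/
theorem exists_packing_bound (C : ℕ → ℕ) {η : ℝ} (hη : 0 < η) :
    ∃ M : ℝ, 0 < M ∧
      ∀ (X : Type u) [Fintype X] [DecidableEq X] [MeasurableSpace X] [MeasurableSingletonClass X]
        (P : Measure X) [IsProbabilityMeasure P] (𝓡 : Finset (Finset X)), ShallowBound C 𝓡 →
        ∀ (𝓠 : Finset (Finset X)) (r : ℝ) (U : Finset X), 0 < r → 𝓠 ⊆ 𝓡 → (∀ A ∈ 𝓠, A ⊆ U) →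
        (∀ A ∈ 𝓠, P.real (A : Set X) ≤ 2 * r) →
        (∀ A ∈ 𝓠, ∀ B ∈ 𝓠, A ≠ B → η * r ≤ P.real ((symmDiff A B : Finset X) : Set X)) →
        (#𝓠 : ℝ) ≤ M * (P.real (U : Set X) / r + 1) := by
  set d := 4 * C 2 + 3 with hd
  obtain ⟨k, hk⟩ := exists_nat_ge (4 * (4 * d * (2 / η) + 1))
  refine ⟨4 * C k * (4 * d / η) + 8 * C k + 1, by positivity, ?_⟩
  intro X _ _ _ _ P _ 𝓡 hC 𝓠 r U hr h𝓠 hU hsmall hsep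
  have hu0 : 0 ≤ P.real (U : Set X) := measureReal_nonneg
  -- If `U` is null one cannot condition on it, but then distinct members would be at distance zero,
  -- so there is at most one.
  rcases hu0.eq_or_lt with h0 | h0
  · have h1 : #𝓠 ≤ 1 := by
      refine card_le_one.2 fun A hA B hB => ?_
      by_contra hAB
      have h1 := hsep A hA B hB hAB
      have h2 : P.real ((symmDiff A B : Finset X) : Set X) ≤ P.real (U : Set X) := by
        refine measureReal_mono ?_
        rw [coe_subset]
        exact symmDiff_le_sup.trans (union_subset (hU A hA) (hU B hB))
      have : 0 < η * r := by positivity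
      linarith
    rw [← h0, zero_div, zero_add, mul_one]
    have h2 : (#𝓠 : ℝ) ≤ 1 := by exact_mod_cast h1
    have h3 : 0 ≤ 4 * C k * (4 * d / η) + 8 * (C k : ℝ) := by positivity
    linarith
  · set u := P.real (U : Set X) with hu
    have hcond : ∀ A : Finset X, A ⊆ U →
        ∑ x ∈ A, condWeight P U x = P.real (A : Set X) / u := by
      intro A hA
      rw [sum_condWeight, inter_eq_left.2 hA]
    -- Conditioning divides the separation and the size bound by the same u, so their ratio `ρ`, and
    -- with it `k`, is independent of `U`; only 4d/δ, of order u/r, depends on it.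
    have h := hC.card_le_of_separated (d := d) (by omega) hC.vcDim_le (condWeight_nonneg P U)
      (sum_univ_condWeight P h0) (δ := η * r / u) (ρ := 2 / η) (by positivity) (by positivity) h𝓠
      (fun A hA B hB hAB => by
        rw [hcond _ (symmDiff_le_sup.trans (union_subset (hU A hA) (hU B hB)))]
        have := hsep A hA B hB hAB
        gcongr)
      (fun A hA => by
        rw [hcond _ (hU A hA)]
        have := hsmall A hA
        calc P.real (A : Set X) / u ≤ 2 * r / u := by gcongr
          _ = _ := by field_simp)
      (k := k) (by linarith)
    refine h.trans ?_
    have e : 4 * d / (η * r / u) = 4 * d / η * (u / r) := by field_simp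
    rw [e]
    have h1 : 0 ≤ u / r := by positivity
    have h2 : 0 ≤ 4 * C k * (4 * d / η) := by positivity
    have h3 : (0 : ℝ) ≤ C k := by positivity
    nlinarith [mul_nonneg h3 h1]

/-- The union of the small ranges is controlled by the capacity. -/
theorem measureReal_smallRanges_le {X : Type*} [Fintype X] [DecidableEq X] [MeasurableSpace X]
    [MeasurableSingletonClass X] (P : Measure X) [IsProbabilityMeasure P]
    (𝓡 : Finset (Finset X)) {ε r : ℝ} (hε : 0 < ε) (hr : ε ≤ r) :
    P.real (((smallRanges P 𝓡 r).biUnion id : Finset X) : Set X) / r ≤ capacity P 𝓡 ε := by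
  refine le_trans ?_ (le_max_left _ _)
  refine le_trans (le_of_eq ?_) (le_ciSup (bddAbove_capacity P 𝓡 hε) ⟨r, hr⟩)
  simp

theorem packingNumber_le {X : Type*} [MeasurableSpace X] [DecidableEq X] {P : Measure X}
    {𝓡 : Finset (Finset X)} {r : ℝ} {n : ℕ} (h : ∀ 𝓠 ⊆ 𝓡,
      (∀ A ∈ 𝓠, ∀ B ∈ 𝓠, A ≠ B → r ≤ P.real ((symmDiff A B : Finset X) : Set X)) → #𝓠 ≤ n) :
    packingNumber P 𝓡 r ≤ n :=
  Finset.sup_le fun 𝓠 h𝓠 =>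
    h 𝓠 (mem_powerset.1 (mem_filter.1 h𝓠).1) (mem_filter.1 h𝓠).2

/-- The ranges of measure at most 2r have a union of measure at most 2rτ(ε), because 2r ≥ ε. The
packing bound with η = 1 then gives M(2τ + 1) ≤ 3Mτ. -/
theorem exists_doublingConstant_le (C : ℕ → ℕ) :
    ∃ K : ℝ, 0 < K ∧
      ∀ (X : Type u) [Fintype X] [DecidableEq X] [MeasurableSpace X] [MeasurableSingletonClass X]
        (P : Measure X) [IsProbabilityMeasure P] (𝓡 : Finset (Finset X)), ShallowBound C 𝓡 →
        ∀ ε : ℝ, 0 < ε → (doublingConstant P 𝓡 ε : ℝ) ≤ K * capacity P 𝓡 ε := by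
  obtain ⟨M, hM, h⟩ := exists_packing_bound.{u} C one_pos
  refine ⟨3 * M, by positivity, ?_⟩
  intro X _ _ _ _ P _ 𝓡 hC ε hε
  have hτ : 1 ≤ capacity P 𝓡 ε := le_max_right _ _
  have hfloor : doublingConstant P 𝓡 ε ≤ ⌊3 * M * capacity P 𝓡 ε⌋₊ := by
    refine ciSup_le fun ⟨r, hr⟩ => packingNumber_le fun 𝓠 h𝓠 hsep =>
      Nat.le_floor ?_
    have hr : ε ≤ r := hr
    have hr0 : 0 < r := hε.trans_le hr
    have h1 := h X P 𝓡 hC 𝓠 r ((smallRanges P 𝓡 (2 * r)).biUnion id) hr0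
      (h𝓠.trans (filter_subset _ _)) (fun A hA => subset_biUnion_of_mem id (h𝓠 hA))
      (fun A hA => (mem_filter.1 (h𝓠 hA)).2) (by simpa using hsep)
    have h2 := measureReal_smallRanges_le P 𝓡 hε (show ε ≤ 2 * r by linarith)
    rw [div_le_iff₀ (by positivity)] at h2
    have h3 : P.real (((smallRanges P 𝓡 (2 * r)).biUnion id : Finset X) : Set X) / r ≤
        2 * capacity P 𝓡 ε := by
      rw [div_le_iff₀ hr0]; linarith
    calc (#𝓠 : ℝ) ≤ _ := h1
      _ ≤ M * (2 * capacity P 𝓡 ε + capacity P 𝓡 ε) := by gcongr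
      _ = _ := by ring
  exact (Nat.cast_le.2 hfloor).trans (Nat.floor_le (by positivity))

/-! ### Nets at one scale and their union over dyadic scales -/

theorem exists_maximal_separated {α : Type*} [DecidableEq α] (s : Finset α) (far : α → α → Prop)
    (hsymm : ∀ a b, far a b → far b a) :
    ∃ q ⊆ s, (∀ a ∈ q, ∀ b ∈ q, a ≠ b → far a b) ∧ ∀ a ∈ s, ∃ b ∈ q, a = b ∨ ¬ far a b := by
  have key : ∀ p : Finset α → Prop, p ∅ →
      ∃ q ⊆ s, p q ∧ ∀ q' ⊆ s, p q' → #q' ≤ #q := by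
    classical
    intro p hp
    obtain ⟨q, hq, hmax⟩ := exists_max_image {q ∈ s.powerset | p q} card ⟨∅, by simp [hp]⟩
    rw [mem_filter, mem_powerset] at hq
    exact ⟨q, hq.1, hq.2, fun q' h1 h2 => hmax q' (mem_filter.2 ⟨mem_powerset.2 h1, h2⟩)⟩
  obtain ⟨q, hqs, hq, hmax⟩ := key (fun q => ∀ a ∈ q, ∀ b ∈ q, a ≠ b → far a b) (by simp)
  refine ⟨q, hqs, hq, fun a ha => ?_⟩
  by_contra hcon
  push Not at hcon
  have haq : a ∉ q := fun h => (hcon a h).1 rfl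
  have := hmax (insert a q) (insert_subset ha hqs) (by
    intro b hb c hc hbc
    rcases mem_insert.1 hb with hb' | hb' <;> rcases mem_insert.1 hc with hc' | hc'
    · exact absurd (hb'.trans hc'.symm) hbc
    · exact hb' ▸ (hcon c hc').2
    · exact hsymm _ _ (hc' ▸ (hcon b hb').2)
    · exact hq b hb' c hc' hbc)
  rw [card_insert_of_notMem haq] at this
  omega

section Scale

variable {X : Type*} [Fintype X] [DecidableEq X] [MeasurableSpace X] [MeasurableSingletonClass X]

/-- Inside a set `A` of positive measure, few points hit all ranges that almost contain `A`. -/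
theorem exists_net_inside {d t : ℕ} (ht0 : 0 < t)
    (ht : 2 * ∑ k ∈ Iic d, (2 * t).choose k < (2 * t).choose t) (P : Measure X)
    [IsProbabilityMeasure P] {𝓡 : Finset (Finset X)} (hvc : 𝓡.vcDim ≤ d) (A : Finset X)
    (hA : 0 < P.real (A : Set X)) :
    ∃ S : Finset X, #S ≤ t ∧ (∀ x ∈ S, 0 < P {x}) ∧ ∀ R ∈ 𝓡,
      P.real ((symmDiff R A : Finset X) : Set X) ≤ 1 / (2 * t : ℝ) * P.real (A : Set X) →
        ∃ x ∈ S, x ∈ R := by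
  obtain ⟨S, hS1, hS2, hS3⟩ :=
    exists_small_net ht0 ht (condWeight_nonneg P A) (sum_univ_condWeight P hA) hvc
  refine ⟨S, hS1, fun x hx => ?_, fun R hR hRA => hS3 R hR ?_⟩
  · have h := hS2 x hx
    unfold condWeight at h
    split_ifs at h with hxA
    · refine pos_iff_ne_zero.2 fun h0 => ?_
      rw [measureReal_def, h0] at h
      simp at h
    · exact absurd h (lt_irrefl _)
  · rw [sum_condWeight, le_div_iff₀ hA]
    have h1 : P.real (A : Set X) ≤ P.real ((R ∩ A : Finset X) : Set X) +
        P.real ((symmDiff R A : Finset X) : Set X) := by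
      refine le_trans (measureReal_mono ?_) (measureReal_union_le _ _)
      rw [← coe_union, coe_subset]
      intro x hx
      by_cases hxR : x ∈ R <;> simp [mem_symmDiff, hx, hxR]
    linarith

end Scale

/-- A net for the ranges of measure between `r` and `2 r`. -/
theorem exists_scale_net (C : ℕ → ℕ) :
    ∃ M : ℝ, 0 < M ∧
      ∀ (X : Type u) [Fintype X] [DecidableEq X] [MeasurableSpace X] [MeasurableSingletonClass X]
        (P : Measure X) [IsProbabilityMeasure P] (𝓡 : Finset (Finset X)), ShallowBound C 𝓡 →
        ∀ ε r : ℝ, 0 < ε → ε ≤ r → ∃ S : Finset X, (∀ x ∈ S, 0 < P {x}) ∧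
          (∀ R ∈ 𝓡, r ≤ P.real (R : Set X) → P.real (R : Set X) ≤ 2 * r → ∃ x ∈ S, x ∈ R) ∧
          (#S : ℝ) ≤ M * capacity P 𝓡 ε ∧ (#S : ℝ) ≤ M * (1 / r + 1) := by
  obtain ⟨t, ht0, ht⟩ := exists_two_mul_sauer_lt_choose (4 * C 2 + 3)
  have ht0' : (0 : ℝ) < t := by exact_mod_cast ht0
  obtain ⟨M, hM, hpack⟩ := exists_packing_bound.{u} C (η := 1 / (2 * t : ℝ)) (by positivity)
  refine ⟨3 * M * t, by positivity, ?_⟩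
  intro X _ _ _ _ P _ 𝓡 hC ε r hε hr
  have hr0 : 0 < r := hε.trans_le hr
  have hτ : 1 ≤ capacity P 𝓡 ε := le_max_right _ _
  -- The separation r/(2t) is matched to `exists_net_inside`: by maximality every range `R` of this
  -- scale differs from some `A ∈ 𝓠` by at most P(A)/(2t).
  obtain ⟨𝓠, h𝓠, hsep, hmax⟩ := exists_maximal_separated
    (𝓡.filter fun R : Finset X => r ≤ P.real (R : Set X) ∧ P.real (R : Set X) ≤ 2 * r)
    (fun A B : Finset X => 1 / (2 * t : ℝ) * r ≤ P.real ((symmDiff A B : Finset X) : Set X))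
    (fun A B h => by rwa [symmDiff_comm])
  have hmem : ∀ A ∈ 𝓠, A ∈ 𝓡 ∧ r ≤ P.real (A : Set X) ∧ P.real (A : Set X) ≤ 2 * r :=
    fun A hA => mem_filter.1 (h𝓠 hA)
  have hpos : ∀ A ∈ 𝓠, 0 < P.real (A : Set X) := fun A hA => hr0.trans_le (hmem A hA).2.1
  have hnet : ∀ A : Finset X, ∃ S : Finset X, A ∈ 𝓠 → #S ≤ t ∧ (∀ x ∈ S, 0 < P {x}) ∧
      ∀ R ∈ 𝓡, P.real ((symmDiff R A : Finset X) : Set X) ≤ 1 / (2 * t : ℝ) * P.real (A : Set X) →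
        ∃ x ∈ S, x ∈ R := by
    intro A
    by_cases hA : A ∈ 𝓠
    · obtain ⟨S, hS⟩ := exists_net_inside ht0 ht P hC.vcDim_le A (hpos A hA)
      exact ⟨S, fun _ => hS⟩
    · exact ⟨∅, fun h => absurd h hA⟩
  choose S hS using hnet
  have hcard : (#(𝓠.biUnion S) : ℝ) ≤ t * #𝓠 := by
    have : #(𝓠.biUnion S) ≤ #𝓠 * t := card_biUnion_le_card_mul _ _ _ fun A hA => (hS A hA).1
    rw [mul_comm]
    exact_mod_cast this
  have hpk : (#𝓠 : ℝ) ≤ M *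
      (P.real (((smallRanges P 𝓡 (2 * r)).biUnion id : Finset X) : Set X) / r + 1) :=
    hpack X P 𝓡 hC 𝓠 r _ hr0 (fun A hA => (hmem A hA).1)
      (fun A hA => subset_biUnion_of_mem id
        (mem_filter.2 ⟨(hmem A hA).1, (hmem A hA).2.2⟩))
      (fun A hA => (hmem A hA).2.2) hsep
  refine ⟨𝓠.biUnion S, ?_, ?_, ?_, ?_⟩
  · intro x hx
    obtain ⟨A, hA, hxA⟩ := mem_biUnion.1 hx
    exact (hS A hA).2.1 x hxA
  · intro R hR h1 h2
    obtain ⟨A, hA, hRA⟩ := hmax R (mem_filter.2 ⟨hR, h1, h2⟩)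
    have hRA' : P.real ((symmDiff R A : Finset X) : Set X) ≤
        1 / (2 * t : ℝ) * P.real (A : Set X) := by
      rcases hRA with rfl | hRA
      · simp only [symmDiff_self, bot_eq_empty, coe_empty, measureReal_empty]
        positivity
      · refine (not_le.1 hRA).le.trans ?_
        gcongr
        exact (hmem A hA).2.1
    obtain ⟨x, hx, hxR⟩ := (hS A hA).2.2 R hR hRA'
    exact ⟨x, mem_biUnion.2 ⟨A, hA, hx⟩, hxR⟩
  · have h2 := measureReal_smallRanges_le P 𝓡 hε (show ε ≤ 2 * r by linarith)
    rw [div_le_iff₀ (by positivity)] at h2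
    have h3 : P.real (((smallRanges P 𝓡 (2 * r)).biUnion id : Finset X) : Set X) / r ≤
        2 * capacity P 𝓡 ε := by
      rw [div_le_iff₀ hr0]; linarith
    calc (#(𝓠.biUnion S) : ℝ) ≤ t * #𝓠 := hcard
      _ ≤ t * (M * (2 * capacity P 𝓡 ε + capacity P 𝓡 ε)) := by
        gcongr
        exact hpk.trans (by gcongr)
      _ = _ := by ring
  · calc (#(𝓠.biUnion S) : ℝ) ≤ t * #𝓠 := hcard
      _ ≤ t * (M * (1 / r + 1)) := by
        gcongr
        refine hpk.trans ?_
        gcongr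
        exact measureReal_le_one
      _ ≤ t * (M * (1 / r + 1)) * 3 := by
        have : 0 ≤ t * (M * (1 / r + 1)) := by positivity
        linarith
      _ = _ := by ring

/-- The nets of the scales 2^k ε ≤ 1 are united. The number of scales times the bound in terms of τ
gives one term of the minimum, the geometric sum of the bounds 1/(2^k ε) + 1 gives the other. -/
theorem exists_epsNet (C : ℕ → ℕ) {a : ℝ} (ha : a < 1) :
    ∃ K : ℝ, 0 < K ∧
      ∀ (X : Type u) [Fintype X] [DecidableEq X] [MeasurableSpace X] [MeasurableSingletonClass X]
        (P : Measure X) [IsProbabilityMeasure P] (𝓡 : Finset (Finset X)), ShallowBound C 𝓡 →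
        ∀ ε : ℝ, 0 < ε → ε ≤ a → ∃ S : Finset X, IsEpsNet P 𝓡 ε S ∧
          (#S : ℝ) ≤ K * min (capacity P 𝓡 ε * Real.log (1 / ε)) (1 / ε) := by
  rcases le_or_gt a 0 with ha0 | ha0
  · exact ⟨1, one_pos, fun X _ _ _ _ P _ 𝓡 _ ε h1 h2 => absurd (h1.trans_le h2) ha0.not_gt⟩
  obtain ⟨M, hM, hscale⟩ := exists_scale_net.{u} C
  have hl2 : 0 < Real.log 2 := Real.log_pos one_lt_two
  have hla : 0 < Real.log (1 / a) := Real.log_pos (by rw [lt_div_iff₀ ha0]; linarith)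
  -- There are n + 1 scales: n ≤ log(1/ε)/log 2, and the extra one is absorbed by 1 ≤
  -- log(1/ε)/log(1/a).
  set L := 1 / Real.log 2 + 1 / Real.log (1 / a) with hL
  have hL0 : 0 < L := by positivity
  refine ⟨M * L + 4 * M, by positivity, ?_⟩
  intro X _ _ _ _ P _ 𝓡 hC ε hε hεa
  have hτ : 1 ≤ capacity P 𝓡 ε := le_max_right _ _
  have h1ε : 1 ≤ 1 / ε := by rw [le_div_iff₀ hε]; linarith
  obtain ⟨n, hn1, hn2⟩ := exists_nat_pow_near h1ε one_lt_two
  have hscale' : ∀ k : ℕ, ∃ S : Finset X, (∀ x ∈ S, 0 < P {x}) ∧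
      (∀ R ∈ 𝓡, 2 ^ k * ε ≤ P.real (R : Set X) → P.real (R : Set X) ≤ 2 * (2 ^ k * ε) →
        ∃ x ∈ S, x ∈ R) ∧
      (#S : ℝ) ≤ M * capacity P 𝓡 ε ∧ (#S : ℝ) ≤ M * (1 / (2 ^ k * ε) + 1) := fun k =>
    hscale X P 𝓡 hC ε (2 ^ k * ε) hε (le_mul_of_one_le_left hε.le (one_le_pow₀ one_le_two))
  choose S hS1 hS2 hS3 hS4 using hscale'
  have hcard : (#((range (n + 1)).biUnion S) : ℝ) ≤ ∑ k ∈ range (n + 1), (#(S k) : ℝ) := by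
    exact_mod_cast card_biUnion_le
  refine ⟨(range (n + 1)).biUnion S, ⟨?_, ?_⟩, ?_⟩
  · intro x hx
    obtain ⟨k, -, hxk⟩ := mem_biUnion.1 hx
    exact hS1 k x hxk
  · intro R hR hRε
    have h1 : 1 ≤ P.real (R : Set X) / ε := by rw [le_div_iff₀ hε]; linarith
    obtain ⟨k, hk1, hk2⟩ := exists_nat_pow_near h1 (one_lt_two (α := ℝ))
    have hkn : k < n + 1 := by
      have : (2 : ℝ) ^ k < 2 ^ (n + 1) :=
        hk1.trans_lt (lt_of_le_of_lt (by gcongr; exact measureReal_le_one) hn2)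
      exact (pow_lt_pow_iff_right₀ one_lt_two).1 this
    rw [le_div_iff₀ hε] at hk1
    rw [div_lt_iff₀ hε, pow_succ] at hk2
    obtain ⟨x, hx, hxR⟩ := hS2 k R hR hk1 (by linarith)
    exact ⟨x, mem_biUnion.2 ⟨k, mem_range.2 hkn, hx⟩, hxR⟩
  · have hlog : Real.log (1 / a) ≤ Real.log (1 / ε) :=
      Real.log_le_log (by positivity) (one_div_le_one_div_of_le hε hεa)
    have hlogε : 0 < Real.log (1 / ε) := hla.trans_le hlog
    have hnL : ((n + 1 : ℕ) : ℝ) ≤ L * Real.log (1 / ε) := by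
      have h1 : n * Real.log 2 ≤ Real.log (1 / ε) := by
        rw [← Real.log_pow]
        exact Real.log_le_log (by positivity) hn1
      rw [← le_div_iff₀ hl2] at h1
      have h2 : 1 ≤ Real.log (1 / ε) / Real.log (1 / a) := by rwa [le_div_iff₀ hla, one_mul]
      have h3 : L * Real.log (1 / ε) =
          Real.log (1 / ε) / Real.log 2 + Real.log (1 / ε) / Real.log (1 / a) := by
        rw [hL]; ring
      rw [h3]
      push_cast
      linarith
    have hb1 : (#((range (n + 1)).biUnion S) : ℝ) ≤
        M * L * (capacity P 𝓡 ε * Real.log (1 / ε)) := by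
      calc _ ≤ ∑ k ∈ range (n + 1), (#(S k) : ℝ) := hcard
        _ ≤ ∑ k ∈ range (n + 1), M * capacity P 𝓡 ε := sum_le_sum fun k _ => hS3 k
        _ = ((n + 1 : ℕ) : ℝ) * (M * capacity P 𝓡 ε) := by
          rw [sum_const, card_range, nsmul_eq_mul]
        _ ≤ L * Real.log (1 / ε) * (M * capacity P 𝓡 ε) := by gcongr
        _ = _ := by ring
    have hb2 : (#((range (n + 1)).biUnion S) : ℝ) ≤ 4 * M * (1 / ε) := by
      calc _ ≤ ∑ k ∈ range (n + 1), (#(S k) : ℝ) := hcard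
        _ ≤ ∑ k ∈ range (n + 1), 2 * M * (1 / ε) * (1 / 2) ^ k := by
          refine sum_le_sum fun k hk => (hS4 k).trans ?_
          have hk' : (2 : ℝ) ^ k * ε ≤ 1 := by
            have : (2 : ℝ) ^ k ≤ 2 ^ n :=
              pow_le_pow_right₀ one_le_two (Nat.lt_succ_iff.1 (mem_range.1 hk))
            rw [← le_div_iff₀ hε]
            exact this.trans hn1
          have h1 : 1 ≤ 1 / (2 ^ k * ε) := by rwa [le_div_iff₀ (by positivity), one_mul]
          have h2 : 2 * M * (1 / ε) * (1 / 2) ^ k = M * (1 / (2 ^ k * ε) + 1 / (2 ^ k * ε)) := by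
            rw [div_pow, one_pow]; field_simp; ring
          rw [h2]
          gcongr
        _ = 2 * M * (1 / ε) * ∑ k ∈ range (n + 1), (1 / 2 : ℝ) ^ k := by rw [mul_sum]
        _ ≤ 2 * M * (1 / ε) * 2 := by
          gcongr
          exact sum_geometric_two_le _
        _ = _ := by ring
    have hm1 : 0 ≤ capacity P 𝓡 ε * Real.log (1 / ε) := by positivity
    have hm2 : 0 ≤ 1 / ε := by positivity
    rw [mul_min_of_nonneg _ _ (by positivity)]
    refine le_min ?_ ?_
    · nlinarith [mul_nonneg hM.le hm1]
    · nlinarith [mul_nonneg (mul_pos hM hL0).le hm2]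

open Filter Topology

/-! ### Lower envelopes of planes and shallow crossings -/

section Envelope

/-- The value at `u` of the affine function on the plane with coefficients `p`. -/
def height (p : ℝ × ℝ × ℝ) (u : ℝ × ℝ) : ℝ := p.1 * u.1 + p.2.1 * u.2 + p.2.2

variable {I : Type*} [Fintype I] [DecidableEq I]

/-- General position of the affine functions `p i`. -/
structure Generic (p : I → ℝ × ℝ × ℝ) : Prop where
  injective : Function.Injective fun i => (p i).2.1
  planar : ∀ i j k, i ≠ j → i ≠ k → j ≠ k →
    ((p j).1 - (p i).1) * ((p k).2.1 - (p i).2.1) -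
      ((p k).1 - (p i).1) * ((p j).2.1 - (p i).2.1) ≠ 0
  not_tie : ∀ i j k l, i ≠ j → i ≠ k → i ≠ l → j ≠ k → j ≠ l → k ≠ l → ∀ u,
    ¬ (height (p j) u = height (p i) u ∧ height (p k) u = height (p i) u ∧
      height (p l) u = height (p i) u)

/-- The functions `x, y, z`, ordered by slope, agree at `u`. -/
structure IsCrossing (p : I → ℝ × ℝ × ℝ) (τ : I × I × I) (u : ℝ × ℝ) : Prop where
  lt_left : (p τ.1).2.1 < (p τ.2.1).2.1
  lt_right : (p τ.2.1).2.1 < (p τ.2.2).2.1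
  eq_left : height (p τ.1) u = height (p τ.2.1) u
  eq_right : height (p τ.2.2) u = height (p τ.2.1) u

theorem ne_of_slope_lt {p : I → ℝ × ℝ × ℝ} {i j : I} (h : (p i).2.1 < (p j).2.1) : i ≠ j := by
  rintro rfl; exact lt_irrefl _ h

theorem IsCrossing.unique {p : I → ℝ × ℝ × ℝ} (hp : Generic p) {τ : I × I × I} {u u' : ℝ × ℝ}
    (h : IsCrossing p τ u) (h' : IsCrossing p τ u') : u = u' := by
  obtain ⟨x, y, z⟩ := τ
  have hxy := ne_of_slope_lt h.lt_left
  have hyz := ne_of_slope_lt h.lt_right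
  have hxz := ne_of_slope_lt (h.lt_left.trans h.lt_right)
  have hdet := hp.planar y x z hxy.symm hyz hxz
  have e1 := h.eq_left
  have e2 := h.eq_right
  have e3 := h'.eq_left
  have e4 := h'.eq_right
  simp only [height] at e1 e2 e3 e4 hdet
  refine Prod.ext ?_ ?_
  · refine sub_eq_zero.1 ((mul_eq_zero.1 ?_).resolve_left hdet)
    linear_combination (e1 - e3) * ((p z).2.1 - (p y).2.1) - (e2 - e4) * ((p x).2.1 - (p y).2.1)
  · refine sub_eq_zero.1 ((mul_eq_zero.1 ?_).resolve_left hdet)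
    linear_combination (e2 - e4) * ((p x).1 - (p y).1) - (e1 - e3) * ((p z).1 - (p y).1)

open Classical in
/-- The vertices of the lower envelope of the functions with indices in `Z`. -/
noncomputable def envelopeVertices (p : I → ℝ × ℝ × ℝ) (Z : Finset I) : Finset (I × I × I) :=
  {τ | τ.1 ∈ Z ∧ τ.2.1 ∈ Z ∧ τ.2.2 ∈ Z ∧ ∃ u, IsCrossing p τ u ∧
    ∀ r ∈ Z, r ≠ τ.1 → r ≠ τ.2.1 → r ≠ τ.2.2 → height (p τ.2.1) u < height (p r) u}

/-- Twice the signed area of the projected triangle of `τ`, seen from its middle vertex. -/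
def crossingSlope (p : I → ℝ × ℝ × ℝ) (τ : I × I × I) : ℝ :=
  ((p τ.2.2).2.1 - (p τ.2.1).2.1) * ((p τ.1).1 - (p τ.2.1).1) +
    ((p τ.2.1).2.1 - (p τ.1).2.1) * ((p τ.2.2).1 - (p τ.2.1).1)

/-- The slope gaps are the weights that cancel the second coordinate. Where the middle function is
lowest the left side is nonnegative, so that region lies on one side of the vertical line through
`u`, the side given by the sign of `crossingSlope`. -/
theorem IsCrossing.combination {p : I → ℝ × ℝ × ℝ} {τ : I × I × I} {u : ℝ × ℝ}
    (h : IsCrossing p τ u) (v : ℝ × ℝ) :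
    ((p τ.2.2).2.1 - (p τ.2.1).2.1) * (height (p τ.1) v - height (p τ.2.1) v) +
      ((p τ.2.1).2.1 - (p τ.1).2.1) * (height (p τ.2.2) v - height (p τ.2.1) v) =
    crossingSlope p τ * (v.1 - u.1) := by
  have e1 := h.eq_left
  have e2 := h.eq_right
  simp only [height, crossingSlope] at *
  linear_combination ((p τ.2.2).2.1 - (p τ.2.1).2.1) * e1 +
    ((p τ.2.1).2.1 - (p τ.1).2.1) * e2

theorem height_le_of_mem_envelope {p : I → ℝ × ℝ × ℝ} {Z : Finset I} {τ : I × I × I} {u : ℝ × ℝ}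
    (h : IsCrossing p τ u)
    (hu : ∀ r ∈ Z, r ≠ τ.1 → r ≠ τ.2.1 → r ≠ τ.2.2 → height (p τ.2.1) u < height (p r) u)
    {r : I} (hr : r ∈ Z) : height (p τ.2.1) u ≤ height (p r) u := by
  by_cases h1 : r = τ.1
  · rw [h1, h.eq_left]
  by_cases h2 : r = τ.2.1
  · rw [h2]
  by_cases h3 : r = τ.2.2
  · rw [h3, h.eq_right]
  exact (hu r hr h1 h2 h3).le

/-- The complexity of a lower envelope of planes is linear. -/
theorem card_envelopeVertices_le {p : I → ℝ × ℝ × ℝ} (hp : Generic p) (Z : Finset I) :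
    #(envelopeVertices p Z) ≤ 2 * #Z := by
  classical
  -- A vertex is determined by its middle function and the sign of its `crossingSlope`. Of two
  -- vertices sharing both, each lies on the same prescribed side of the other, so their first
  -- coordinates agree.
  have hmap : ∀ τ ∈ envelopeVertices p Z,
      (τ.2.1, decide (0 < crossingSlope p τ)) ∈ Z ×ˢ (univ : Finset Bool) := by
    intro τ hτ
    rw [envelopeVertices, mem_filter] at hτ
    exact mem_product.2 ⟨hτ.2.2.1, mem_univ _⟩
  refine (card_le_card_of_injOn _ hmap ?_).trans_eq (by rw [card_product]; simp [mul_comm])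
  rintro τ hτ τ' hτ' heq
  rw [mem_coe, envelopeVertices, mem_filter] at hτ hτ'
  obtain ⟨-, hx, hy, hz, u, hu, hmin⟩ := hτ
  obtain ⟨-, hx', hy', hz', u', hu', hmin'⟩ := hτ'
  simp only [Prod.mk.injEq, decide_eq_decide] at heq
  obtain ⟨hyy, hsign⟩ := heq
  have ne0 : ∀ {τ : I × I × I} {u}, IsCrossing p τ u → crossingSlope p τ ≠ 0 := by
    intro τ u h
    have hdet := hp.planar τ.2.1 τ.1 τ.2.2 (ne_of_slope_lt h.lt_left).symm
      (ne_of_slope_lt h.lt_right) (ne_of_slope_lt (h.lt_left.trans h.lt_right))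
    unfold crossingSlope
    contrapose! hdet
    linear_combination hdet
  have c1 := hu.combination u'
  have c2 := hu'.combination u
  have pl := sub_pos.2 hu.lt_left
  have pr := sub_pos.2 hu.lt_right
  have pl' := sub_pos.2 hu'.lt_left
  have pr' := sub_pos.2 hu'.lt_right
  have a1 : 0 ≤ height (p τ.1) u' - height (p τ.2.1) u' := by
    rw [hyy]; exact sub_nonneg.2 (height_le_of_mem_envelope hu' hmin' hx)
  have a2 : 0 ≤ height (p τ.2.2) u' - height (p τ.2.1) u' := by
    rw [hyy]; exact sub_nonneg.2 (height_le_of_mem_envelope hu' hmin' hz)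
  have a3 : 0 ≤ height (p τ'.1) u - height (p τ'.2.1) u := by
    rw [← hyy]; exact sub_nonneg.2 (height_le_of_mem_envelope hu hmin hx')
  have a4 : 0 ≤ height (p τ'.2.2) u - height (p τ'.2.1) u := by
    rw [← hyy]; exact sub_nonneg.2 (height_le_of_mem_envelope hu hmin hz')
  have b1 : 0 ≤ crossingSlope p τ * (u'.1 - u.1) := by rw [← c1]; positivity
  have b2 : 0 ≤ crossingSlope p τ' * (u.1 - u'.1) := by rw [← c2]; positivity
  have huu : u'.1 - u.1 = 0 := by
    rcases lt_or_gt_of_ne (ne0 hu) with hneg | hpos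
    · have hneg' : crossingSlope p τ' < 0 :=
        lt_of_le_of_ne (not_lt.1 fun h => hneg.not_gt (hsign.2 h)) (ne0 hu')
      nlinarith [nonpos_of_mul_nonneg_right b1 hneg, nonpos_of_mul_nonneg_right b2 hneg']
    · have hpos' := hsign.1 hpos
      linarith [nonneg_of_mul_nonneg_right b1 hpos, nonneg_of_mul_nonneg_right b2 hpos']
  rw [huu, mul_zero] at c1
  have t1 : height (p τ.1) u' = height (p τ'.2.1) u' := by
    rw [← hyy]
    have := (add_eq_zero_iff_of_nonneg (mul_nonneg pr.le a1) (mul_nonneg pl.le a2)).1 c1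
    exact sub_eq_zero.1 ((mul_eq_zero.1 this.1).resolve_left pr.ne')
  have t2 : height (p τ.2.2) u' = height (p τ'.2.1) u' := by
    rw [← hyy]
    have := (add_eq_zero_iff_of_nonneg (mul_nonneg pr.le a1) (mul_nonneg pl.le a2)).1 c1
    exact sub_eq_zero.1 ((mul_eq_zero.1 this.2).resolve_left pl.ne')
  -- At `u'` only the three functions of `τ'` attain the minimum, and the order of slopes excludes
  -- the other two positions.
  have m1 : τ.1 = τ'.1 := by
    by_contra hne
    refine (hmin' _ hx hne (hyy ▸ ne_of_slope_lt hu.lt_left) ?_).ne' t1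
    intro h
    have := hu.lt_left
    rw [h, hyy] at this
    exact this.not_gt hu'.lt_right
  have m2 : τ.2.2 = τ'.2.2 := by
    by_contra hne
    refine (hmin' _ hz ?_ (hyy ▸ (ne_of_slope_lt hu.lt_right).symm) hne).ne' t2
    intro h
    have := hu.lt_right
    rw [h, hyy] at this
    exact this.not_gt hu'.lt_left
  exact Prod.ext m1 (Prod.ext hyy m2)

open Classical in
/-- The crossings of three functions below which there are at most `k` other functions. -/
noncomputable def shallowCrossings (p : I → ℝ × ℝ × ℝ) (k : ℕ) : Finset (I × I × I) :=
  {τ | ∃ u, IsCrossing p τ u ∧ #{r | height (p r) u < height (p τ.2.1) u} ≤ k}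

/-- Clarkson–Shor, by counting all subsets `Z`: a shallow crossing is an envelope vertex of every
`Z` that contains its three indices and avoids the at most `k` functions below, hence of at least
2^(N − k − 3) subsets, while each `Z` has at most 2N envelope vertices. -/
theorem card_shallowCrossings_le {p : I → ℝ × ℝ × ℝ} (hp : Generic p) (k : ℕ) :
    #(shallowCrossings p k) ≤ 2 ^ (k + 4) * Fintype.card I := by
  classical
  set N := Fintype.card I with hN
  have hτ : ∀ τ ∈ shallowCrossings p k,
      2 ^ N ≤ 2 ^ (k + 3) * #{Z ∈ (univ : Finset I).powerset | τ ∈ envelopeVertices p Z} := by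
    intro τ hτ
    rw [shallowCrossings, mem_filter] at hτ
    obtain ⟨-, u, hu, hk⟩ := hτ
    set Q : Finset I := {r | height (p r) u < height (p τ.2.1) u} with hQ
    set t : Finset I := {τ.1, τ.2.1, τ.2.2} with ht
    have ht3 : #t ≤ 3 := card_le_three
    set G := (Q ∪ t)ᶜ with hG
    have hGc : N ≤ #G + (k + 3) := by
      have h1 : #(Q ∪ t) + #G = N := card_add_card_compl _
      have h2 := card_union_le Q t
      omega
    have hGle : #G.powerset ≤
        #{Z ∈ (univ : Finset I).powerset | τ ∈ envelopeVertices p Z} := by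
      refine card_le_card_of_injOn (fun Z => Z ∪ t) ?_ ?_
      · intro Z hZ
        rw [mem_coe, mem_powerset] at hZ
        rw [mem_coe, mem_filter, envelopeVertices, mem_filter]
        refine ⟨mem_powerset.2 (subset_univ _), mem_univ _, by simp [ht], by simp [ht],
          by simp [ht], u, hu, fun r hr h1 h2 h3 => ?_⟩
        have hrG : r ∈ G := by
          rcases mem_union.1 hr with hr | hr
          · exact hZ hr
          · simp [ht, h1, h2, h3] at hr
        have hrQ : ¬ height (p r) u < height (p τ.2.1) u := by
          intro h
          rw [hG, mem_compl, mem_union] at hrG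
          exact hrG (Or.inl (by rw [hQ, mem_filter]; exact ⟨mem_univ _, h⟩))
        refine lt_of_le_of_ne (not_lt.1 hrQ) fun he => ?_
        exact hp.not_tie τ.2.1 τ.1 τ.2.2 r (ne_of_slope_lt hu.lt_left).symm
          (ne_of_slope_lt hu.lt_right) h2.symm
          (ne_of_slope_lt (hu.lt_left.trans hu.lt_right)) h1.symm h3.symm u
          ⟨hu.eq_left, hu.eq_right, he.symm⟩
      · have hdis : ∀ Z ∈ G.powerset, (Z ∪ t) \ t = Z := by
          intro Z hZ
          refine union_sdiff_cancel_right (disjoint_left.2 fun r hr hrt => ?_)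
          have := (mem_powerset.1 hZ) hr
          rw [hG, mem_compl, mem_union] at this
          exact this (Or.inr hrt)
        intro Z hZ Z' hZ' h
        rw [← hdis Z hZ, ← hdis Z' hZ']
        exact congrArg (· \ t) h
    rw [card_powerset] at hGle
    calc 2 ^ N ≤ 2 ^ (#G + (k + 3)) := Nat.pow_le_pow_right two_pos hGc
      _ = 2 ^ (k + 3) * 2 ^ #G := by rw [pow_add, mul_comm]
      _ ≤ _ := Nat.mul_le_mul_left _ hGle
  have h1 := card_nsmul_le_sum _ _ _ hτ
  have h2 : ∑ τ ∈ shallowCrossings p k,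
      #{Z ∈ (univ : Finset I).powerset | τ ∈ envelopeVertices p Z} ≤ 2 ^ N * (2 * N) := by
    calc _ ≤ ∑ τ, #{Z ∈ (univ : Finset I).powerset | τ ∈ envelopeVertices p Z} :=
          sum_le_sum_of_subset (subset_univ _)
      _ = ∑ Z ∈ (univ : Finset I).powerset, #(envelopeVertices p Z) := by
          simp_rw [card_filter]
          rw [sum_comm]
          refine sum_congr rfl fun Z _ => ?_
          rw [← card_filter]
          congr 1
          ext τ; simp
      _ ≤ ∑ Z ∈ (univ : Finset I).powerset, 2 * N :=
          sum_le_sum fun Z _ => (card_envelopeVertices_le hp Z).trans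
            (Nat.mul_le_mul_left 2 (card_le_univ Z))
      _ = _ := by rw [sum_const, card_powerset, smul_eq_mul, card_univ]
  rw [← mul_sum, smul_eq_mul] at h1
  have h3 : #(shallowCrossings p k) * 2 ^ N ≤ (2 ^ (k + 4) * N) * 2 ^ N := by
    refine h1.trans ((Nat.mul_le_mul_left _ h2).trans (le_of_eq ?_))
    ring
  exact Nat.le_of_mul_le_mul_right h3 (by positivity)

end Envelope

/-! ### Separable sets and crossings -/

section Envelope

variable {I : Type*} [Fintype I] [DecidableEq I]

theorem continuous_height (p : ℝ × ℝ × ℝ) : Continuous (height p) := by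
  unfold height; fun_prop

/-- At a leftmost point of the region where the functions of `T` are below all others, some
constraint with slope of a prescribed sign is tight. -/
theorem exists_tight {p : I → ℝ × ℝ × ℝ} (hp : Generic p) {T : Finset I} {w : ℝ × ℝ}
    (hw : ∀ x ∈ T, ∀ z ∉ T, height (p x) w ≤ height (p z) w)
    (hmin : ∀ v : ℝ × ℝ, (∀ x ∈ T, ∀ z ∉ T, height (p x) v ≤ height (p z) v) →
      v.1 ≤ w.1 → w.1 ≤ v.1) {σ : ℝ} (hσ : σ ≠ 0) :
    ∃ x ∈ T, ∃ z ∉ T, height (p x) w = height (p z) w ∧ 0 < σ * ((p z).2.1 - (p x).2.1) := by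
  by_contra hcon
  push Not at hcon
  -- Otherwise a small shift of the second coordinate against `σ` makes every constraint strict,
  -- which leaves room to move left and contradicts `hmin`.
  have step1 : ∀ᶠ η in 𝓝[>] (0 : ℝ), ∀ x ∈ T, ∀ z ∈ Tᶜ,
      height (p x) (w.1, w.2 - η * σ) < height (p z) (w.1, w.2 - η * σ) := by
    rw [eventually_all_finset]
    intro x hx
    rw [eventually_all_finset]
    intro z hz
    rw [mem_compl] at hz
    rcases (hw x hx z hz).eq_or_lt with h | h
    · filter_upwards [self_mem_nhdsWithin] with η hη
      have hη : 0 < η := hη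
      have h1 := hcon x hx z hz h
      have h2 : σ * ((p z).2.1 - (p x).2.1) < 0 := by
        refine lt_of_le_of_ne h1 (mul_ne_zero hσ (sub_ne_zero.2 fun he => ?_))
        exact hz (hp.injective he ▸ hx)
      have h3 := mul_neg_of_pos_of_neg hη h2
      simp only [height] at h ⊢
      linarith
    · have hc : ∀ i, ContinuousAt (fun η : ℝ => height (p i) (w.1, w.2 - η * σ)) 0 := fun i =>
        ((continuous_height (p i)).comp (by fun_prop)).continuousAt
      refine ((hc x).eventually_lt (hc z) ?_).filter_mono nhdsWithin_le_nhds
      simpa using h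
  obtain ⟨η, hη⟩ := step1.exists
  have step2 : ∀ᶠ θ in 𝓝[>] (0 : ℝ), ∀ x ∈ T, ∀ z ∈ Tᶜ,
      height (p x) (w.1 - θ, w.2 - η * σ) < height (p z) (w.1 - θ, w.2 - η * σ) := by
    rw [eventually_all_finset]
    intro x hx
    rw [eventually_all_finset]
    intro z hz
    have hc : ∀ i, ContinuousAt (fun θ : ℝ => height (p i) (w.1 - θ, w.2 - η * σ)) 0 := fun i =>
      ((continuous_height (p i)).comp (by fun_prop)).continuousAt
    refine ((hc x).eventually_lt (hc z) ?_).filter_mono nhdsWithin_le_nhds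
    simpa using hη x hx z hz
  obtain ⟨θ, hθ, hθ0⟩ := (step2.and self_mem_nhdsWithin).exists
  have hθ0 : 0 < θ := hθ0
  have := hmin (w.1 - θ, w.2 - η * σ) (fun x hx z hz => (hθ x hx z (mem_compl.2 hz)).le)
    (by simp only; linarith)
  simp only at this
  linarith

/-- A leftmost point of the region where the functions of `T` are below all others. -/
theorem exists_leftmost {p : I → ℝ × ℝ × ℝ} {T : Finset I} {x g g' : I} (hx : x ∈ T)
    (hg : g ∉ T) (hg' : g' ∉ T) (h1 : (p x).1 < (p g).1) (h2 : (p x).1 < (p g').1)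
    (h3 : (p x).2.1 < (p g).2.1) (h4 : (p g').2.1 < (p x).2.1) {u : ℝ × ℝ}
    (hu : ∀ x ∈ T, ∀ z ∉ T, height (p x) u < height (p z) u) :
    ∃ w : ℝ × ℝ, (∀ x ∈ T, ∀ z ∉ T, height (p x) w ≤ height (p z) w) ∧
      ∀ v : ℝ × ℝ, (∀ x ∈ T, ∀ z ∉ T, height (p x) v ≤ height (p z) v) →
        v.1 ≤ w.1 → w.1 ≤ v.1 := by
  let D : Set (ℝ × ℝ) :=
    {v | (∀ x ∈ T, ∀ z ∉ T, height (p x) v ≤ height (p z) v) ∧ v.1 ≤ u.1}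
  have hclosed : IsClosed D := by
    refine IsClosed.inter ?_ (isClosed_le continuous_fst continuous_const)
    have : {v : ℝ × ℝ | ∀ x ∈ T, ∀ z ∉ T, height (p x) v ≤ height (p z) v} =
        ⋂ x ∈ T, ⋂ z ∈ (T : Set I)ᶜ, {v | height (p x) v ≤ height (p z) v} := by
      ext v; simp
    change IsClosed {v : ℝ × ℝ | ∀ x ∈ T, ∀ z ∉ T, height (p x) v ≤ height (p z) v}
    rw [this]
    exact isClosed_biInter fun x _ => isClosed_biInter fun z _ =>
      isClosed_le (continuous_height _) (continuous_height _)
  set A := (p g).1 - (p x).1 with hA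
  set A' := (p g').1 - (p x).1 with hA'
  set B := (p g).2.1 - (p x).2.1 with hB
  set B' := (p x).2.1 - (p g').2.1 with hB'
  set E := (p g).2.2 - (p x).2.2 with hE
  set E' := (p g').2.2 - (p x).2.2 with hE'
  have hA0 : 0 < A := sub_pos.2 h1
  have hA'0 : 0 < A' := sub_pos.2 h2
  have hB0 : 0 < B := sub_pos.2 h3
  have hB'0 : 0 < B' := sub_pos.2 h4
  -- In the constraints of `x` against `g` and `g'` the second coordinate has coefficients of
  -- opposite sign. Eliminating it bounds the first coordinate below, as `A` and `A'` are positive;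
  -- together with `v.1 ≤ u.1` they bound the second coordinate on both sides.
  have hcompact : IsCompact D := by
    refine (isCompact_Icc (a := (-(B' * E + B * E') / (B' * A + B * A'), -(A * u.1 + E) / B))
      (b := (u.1, (A' * u.1 + E') / B'))).of_isClosed_subset hclosed ?_
    rintro v ⟨hv, hvu⟩
    have k1 : 0 ≤ A * v.1 + B * v.2 + E := by
      have := hv x hx g hg
      simp only [height] at this
      simp only [hA, hB, hE]; linarith
    have k2 : 0 ≤ A' * v.1 - B' * v.2 + E' := by
      have := hv x hx g' hg'
      simp only [height] at this
      simp only [hA', hB', hE']; linarith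
    refine ⟨⟨?_, ?_⟩, ⟨hvu, ?_⟩⟩
    · simp only
      rw [div_le_iff₀ (by positivity)]
      nlinarith [mul_nonneg hB'0.le k1, mul_nonneg hB0.le k2]
    · simp only
      rw [div_le_iff₀ hB0]
      nlinarith [mul_nonneg hA0.le (sub_nonneg.2 hvu)]
    · simp only
      rw [le_div_iff₀ hB'0]
      nlinarith [mul_nonneg hA'0.le (sub_nonneg.2 hvu)]
  obtain ⟨w, hw, hwmin⟩ := hcompact.exists_isMinOn ⟨u, fun x hx z hz => (hu x hx z hz).le, le_rfl⟩
    continuous_fst.continuousOn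
  exact ⟨w, hw.1, fun v hv hvw => hwmin ⟨hv, hvw.trans hw.2⟩⟩

/-- A separable set is the set of functions below some crossing, up to the crossing itself. -/
theorem exists_crossing {p : I → ℝ × ℝ × ℝ} (hp : Generic p) {T : Finset I} {x g g' : I}
    (hx : x ∈ T) (hg : g ∉ T) (hg' : g' ∉ T) (h1 : (p x).1 < (p g).1) (h2 : (p x).1 < (p g').1)
    (h3 : (p x).2.1 < (p g).2.1) (h4 : (p g').2.1 < (p x).2.1) {u : ℝ × ℝ}
    (hu : ∀ x ∈ T, ∀ z ∉ T, height (p x) u < height (p z) u) :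
    ∃ τ w, IsCrossing p τ w ∧ (∀ r, height (p r) w < height (p τ.2.1) w → r ∈ T) ∧
      ∀ r ∈ T, height (p r) w < height (p τ.2.1) w ∨ r = τ.1 ∨ r = τ.2.1 ∨ r = τ.2.2 := by
  obtain ⟨w, hw, hmin⟩ := exists_leftmost hx hg hg' h1 h2 h3 h4 hu
  obtain ⟨a, ha, b, hb, hab, hs⟩ := exists_tight hp hw hmin one_ne_zero
  obtain ⟨a', ha', b', hb', hab', hs'⟩ := exists_tight hp hw hmin (neg_ne_zero.2 one_ne_zero)
  have hs : (p a).2.1 < (p b).2.1 := by linarith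
  have hs' : (p b').2.1 < (p a').2.1 := by linarith
  have haa' : height (p a) w = height (p a') w :=
    le_antisymm ((hw a ha b' hb').trans hab'.ge) ((hw a' ha' b hb).trans hab.ge)
  have hbelow : ∀ r, height (p r) w < height (p a) w → r ∈ T := by
    intro r hr
    by_contra hrT
    exact (hw a ha r hrT).not_gt hr
  have habove : ∀ r ∈ T, height (p r) w ≤ height (p a) w := fun r hr => hab ▸ hw r hr b hb
  -- All four functions tie at `w`, so two of them coincide; as `a, a' ∈ T` and `b, b' ∉ T`, it is
  -- `a = a'` or `b = b'`, and the shared one has the middle slope.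
  have main : ∃ τ, IsCrossing p τ w ∧ height (p τ.2.1) w = height (p a) w := by
    by_cases e : a = a'
    · subst e
      exact ⟨(b', a, b), ⟨hs', hs, hab'.symm, hab.symm⟩, rfl⟩
    · by_cases e' : b = b'
      · subst e'
        exact ⟨(a, b, a'), ⟨hs, hs', hab, hab'⟩, hab.symm⟩
      · refine absurd ⟨haa'.symm, hab.symm, (haa'.trans hab').symm⟩
          (hp.not_tie a a' b b' e ?_ ?_ ?_ ?_ e' w)
        · rintro rfl; exact hb ha
        · rintro rfl; exact hb' ha
        · rintro rfl; exact hb ha'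
        · rintro rfl; exact hb' ha'
  obtain ⟨τ, hτ, hτa⟩ := main
  refine ⟨τ, w, hτ, fun r hr => hbelow r (hτa ▸ hr), fun r hr => ?_⟩
  rw [hτa]
  by_contra hcon
  push Not at hcon
  obtain ⟨c0, c1, c2, c3⟩ := hcon
  have hr' := le_antisymm (habove r hr) c0
  exact hp.not_tie τ.2.1 τ.1 τ.2.2 r (ne_of_slope_lt hτ.lt_left).symm
    (ne_of_slope_lt hτ.lt_right) c2.symm (ne_of_slope_lt (hτ.lt_left.trans hτ.lt_right))
    c1.symm c3.symm w ⟨hτ.eq_left, hτ.eq_right, hr'.trans hτa.symm⟩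

/-- The separable sets of at most `k` functions are linear in number. -/
theorem card_le_of_separable_generic {p : I → ℝ × ℝ × ℝ} (hp : Generic p) {g g' : I} (k : ℕ)
    (𝓕 : Finset (Finset I)) (hne : ∀ T ∈ 𝓕, T.Nonempty) (hcard : ∀ T ∈ 𝓕, #T ≤ k)
    (hg : ∀ T ∈ 𝓕, g ∉ T ∧ g' ∉ T)
    (hgx : ∀ T ∈ 𝓕, ∀ x ∈ T, (p x).1 < (p g).1 ∧ (p x).1 < (p g').1 ∧
      (p x).2.1 < (p g).2.1 ∧ (p g').2.1 < (p x).2.1)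
    (hsep : ∀ T ∈ 𝓕, ∃ u, ∀ x ∈ T, ∀ z ∉ T, height (p x) u < height (p z) u) :
    #𝓕 ≤ 2 ^ (k + 7) * Fintype.card I := by
  classical
  have hex : ∀ T : Finset I, ∃ τ w, T ∈ 𝓕 → IsCrossing p τ w ∧
      (∀ r, height (p r) w < height (p τ.2.1) w → r ∈ T) ∧
      ∀ r ∈ T, height (p r) w < height (p τ.2.1) w ∨ r = τ.1 ∨ r = τ.2.1 ∨ r = τ.2.2 := by
    intro T
    by_cases hT : T ∈ 𝓕
    · obtain ⟨x, hx⟩ := hne T hT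
      obtain ⟨u, hu⟩ := hsep T hT
      obtain ⟨k1, k2, k3, k4⟩ := hgx T hT x hx
      obtain ⟨τ, w, h⟩ := exists_crossing hp hx (hg T hT).1 (hg T hT).2 k1 k2 k3 k4 hu
      exact ⟨τ, w, fun _ => h⟩
    · exact ⟨(g, g, g), 0, fun h => absurd h hT⟩
  choose τ w h using hex
  -- The crossing determines `T` except for the membership of its own three indices, which three
  -- bits record.
  have hmap : ∀ T ∈ 𝓕, (τ T, decide ((τ T).1 ∈ T), decide ((τ T).2.1 ∈ T), decide ((τ T).2.2 ∈ T))
      ∈ shallowCrossings p k ×ˢ (univ : Finset (Bool × Bool × Bool)) := by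
    intro T hT
    refine mem_product.2 ⟨?_, mem_univ _⟩
    rw [shallowCrossings, mem_filter]
    refine ⟨mem_univ _, w T, (h T hT).1, (card_le_card fun r hr => ?_).trans (hcard T hT)⟩
    exact (h T hT).2.1 r (mem_filter.1 hr).2
  have := card_le_card_of_injOn _ hmap ?_
  · rw [card_product] at this
    have h8 : #(univ : Finset (Bool × Bool × Bool)) = 2 ^ 3 := rfl
    rw [h8] at this
    refine this.trans ((Nat.mul_le_mul_right _ (card_shallowCrossings_le hp k)).trans_eq ?_)
    ring
  · have half : ∀ T ∈ 𝓕, ∀ T' ∈ 𝓕, τ T = τ T' → ((τ T).1 ∈ T ↔ (τ T').1 ∈ T') →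
        ((τ T).2.1 ∈ T ↔ (τ T').2.1 ∈ T') → ((τ T).2.2 ∈ T ↔ (τ T').2.2 ∈ T') → T ⊆ T' := by
      intro T hT T' hT' e0 e1 e2 e3 r hr
      obtain ⟨c1, -, c3⟩ := h T hT
      obtain ⟨c1', c2', -⟩ := h T' hT'
      have hw : w T = w T' := c1.unique hp (e0 ▸ c1')
      rcases c3 r hr with hlt | rfl | rfl | rfl
      · rw [e0, hw] at hlt
        exact c2' r hlt
      · exact e0 ▸ e1.1 hr
      · exact e0 ▸ e2.1 hr
      · exact e0 ▸ e3.1 hr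
    intro T hT T' hT' heq
    simp only [Prod.mk.injEq, decide_eq_decide] at heq
    obtain ⟨e0, e1, e2, e3⟩ := heq
    exact (half T hT T' hT' e0 e1 e2 e3).antisymm
      (half T' hT' T hT e0.symm e1.symm e2.symm e3.symm)

end Envelope

/-! ### Perturbation into general position -/

section Perturbation

/-- A nonzero polynomial has finitely many roots. The constant coefficient, which comes from the
unperturbed points, may vanish; hence the punctured neighbourhood. -/
theorem eventually_cubic_ne_zero {e₀ e₁ e₂ e₃ : ℝ} (h : e₁ ≠ 0 ∨ e₂ ≠ 0 ∨ e₃ ≠ 0) :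
    ∀ᶠ t in 𝓝[≠] (0 : ℝ), e₀ + e₁ * t + e₂ * t ^ 2 + e₃ * t ^ 3 ≠ 0 := by
  open Polynomial in
  let P : ℝ[X] := C e₀ + C e₁ * X + C e₂ * X ^ 2 + C e₃ * X ^ 3
  have hP : P ≠ 0 := by
    intro h0
    have k1 : P.coeff 1 = 0 := by rw [h0]; simp
    have k2 : P.coeff 2 = 0 := by rw [h0]; simp
    have k3 : P.coeff 3 = 0 := by rw [h0]; simp
    simp [P, Polynomial.coeff_C] at k1 k2 k3
    tauto
  rw [eventually_nhdsWithin_iff]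
  have hcl : IsClosed (((P.roots.toFinset : Set ℝ)) \ {0}) :=
    (P.roots.toFinset.finite_toSet.sdiff).isClosed
  filter_upwards [hcl.isOpen_compl.mem_nhds (by simp)] with t ht ht0 he
  refine ht ⟨?_, ht0⟩
  rw [mem_coe, Multiset.mem_toFinset, Polynomial.mem_roots hP, Polynomial.IsRoot.def]
  simpa [P] using he

/-- Translation of the point with parameter `κ` along a moment curve. -/
def perturb (q : ℝ × ℝ × ℝ) (κ t : ℝ) : ℝ × ℝ × ℝ :=
  (q.1 + t * κ ^ 2, q.2.1 + t * κ, q.2.2 + t * κ ^ 3)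

def det3 (r s v : ℝ × ℝ × ℝ) : ℝ :=
  r.1 * (s.2.1 * v.2.2 - s.2.2 * v.2.1) - r.2.1 * (s.1 * v.2.2 - s.2.2 * v.1) +
    r.2.2 * (s.1 * v.2.1 - s.2.1 * v.1)

/-- A tie at `u` means that the nonzero vector (u, 1) is orthogonal to all three differences. -/
theorem det3_eq_zero_of_tie {q r s v : ℝ × ℝ × ℝ} {u : ℝ × ℝ} (h1 : height r u = height q u)
    (h2 : height s u = height q u) (h3 : height v u = height q u) :
    det3 (r - q) (s - q) (v - q) = 0 := by
  simp only [height] at h1 h2 h3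
  simp only [det3, Prod.fst_sub, Prod.snd_sub]
  linear_combination
    h1 * ((s.1 - q.1) * (v.2.1 - q.2.1) - (s.2.1 - q.2.1) * (v.1 - q.1)) -
    h2 * ((r.1 - q.1) * (v.2.1 - q.2.1) - (r.2.1 - q.2.1) * (v.1 - q.1)) +
    h3 * ((r.1 - q.1) * (s.2.1 - q.2.1) - (r.2.1 - q.2.1) * (s.1 - q.1))

variable {I : Type*} [Fintype I] [DecidableEq I]

/-- Each degeneracy forces a polynomial in `t` to vanish whose top coefficient is, up to sign, a
Vandermonde product in the distinct parameters `κ`. -/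
theorem eventually_generic_perturb (p : I → ℝ × ℝ × ℝ) {κ : I → ℝ} (hκ : Function.Injective κ) :
    ∀ᶠ t in 𝓝[≠] (0 : ℝ), Generic fun i => perturb (p i) (κ i) t := by
  have hsub : ∀ i j, i ≠ j → κ j - κ i ≠ 0 := fun i j h => sub_ne_zero.2 fun e => h (hκ e).symm
  have g1 : ∀ᶠ t in 𝓝[≠] (0 : ℝ), ∀ i j, i ≠ j →
      (perturb (p i) (κ i) t).2.1 ≠ (perturb (p j) (κ j) t).2.1 := by
    simp only [eventually_all]
    intro i j hij
    filter_upwards [eventually_cubic_ne_zero (e₀ := (p j).2.1 - (p i).2.1) (e₂ := 0) (e₃ := 0)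
      (Or.inl (hsub i j hij))] with t ht he
    refine ht ?_
    simp only [perturb] at he
    linear_combination -he
  have g2 : ∀ᶠ t in 𝓝[≠] (0 : ℝ), ∀ i j k, i ≠ j → i ≠ k → j ≠ k →
      ((perturb (p j) (κ j) t).1 - (perturb (p i) (κ i) t).1) *
        ((perturb (p k) (κ k) t).2.1 - (perturb (p i) (κ i) t).2.1) -
      ((perturb (p k) (κ k) t).1 - (perturb (p i) (κ i) t).1) *
        ((perturb (p j) (κ j) t).2.1 - (perturb (p i) (κ i) t).2.1) ≠ 0 := by
    simp only [eventually_all]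
    intro i j k hij hik hjk
    have hne : (κ j - κ i) * (κ k - κ i) * (κ j - κ k) ≠ 0 :=
      mul_ne_zero (mul_ne_zero (hsub i j hij) (hsub i k hik)) (hsub k j hjk.symm)
    filter_upwards [eventually_cubic_ne_zero
      (e₀ := ((p j).1 - (p i).1) * ((p k).2.1 - (p i).2.1) -
        ((p k).1 - (p i).1) * ((p j).2.1 - (p i).2.1))
      (e₁ := ((p j).1 - (p i).1) * (κ k - κ i) + (κ j ^ 2 - κ i ^ 2) * ((p k).2.1 - (p i).2.1) -
        ((p k).1 - (p i).1) * (κ j - κ i) - (κ k ^ 2 - κ i ^ 2) * ((p j).2.1 - (p i).2.1))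
      (e₃ := 0) (Or.inr (Or.inl hne))] with t ht he
    refine ht ?_
    simp only [perturb] at he
    linear_combination he
  have g3 : ∀ᶠ t in 𝓝[≠] (0 : ℝ), ∀ i j k l, i ≠ j → i ≠ k → i ≠ l → j ≠ k → j ≠ l → k ≠ l →
      det3 (perturb (p j) (κ j) t - perturb (p i) (κ i) t)
        (perturb (p k) (κ k) t - perturb (p i) (κ i) t)
        (perturb (p l) (κ l) t - perturb (p i) (κ i) t) ≠ 0 := by
    simp only [eventually_all]
    intro i j k l hij hik hil hjk hjl hkl
    have hne : -((κ j - κ i) * (κ k - κ i) * (κ l - κ i) * (κ k - κ j) * (κ l - κ j) *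
        (κ l - κ k)) ≠ 0 :=
      neg_ne_zero.2 (mul_ne_zero (mul_ne_zero (mul_ne_zero (mul_ne_zero (mul_ne_zero
        (hsub i j hij) (hsub i k hik)) (hsub i l hil)) (hsub j k hjk)) (hsub j l hjl))
        (hsub k l hkl))
    let m : I → ℝ × ℝ × ℝ := fun r => (κ r ^ 2, κ r, κ r ^ 3)
    filter_upwards [eventually_cubic_ne_zero
      (e₀ := det3 (p j - p i) (p k - p i) (p l - p i))
      (e₁ := det3 (m j - m i) (p k - p i) (p l - p i) + det3 (p j - p i) (m k - m i) (p l - p i) +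
        det3 (p j - p i) (p k - p i) (m l - m i))
      (e₂ := det3 (m j - m i) (m k - m i) (p l - p i) + det3 (m j - m i) (p k - p i) (m l - m i) +
        det3 (p j - p i) (m k - m i) (m l - m i))
      (Or.inr (Or.inr hne))] with t ht he
    refine ht ?_
    simp only [det3, perturb, m, Prod.fst_sub, Prod.snd_sub] at he ⊢
    linear_combination he
  filter_upwards [g1, g2, g3] with t h1 h2 h3
  refine ⟨fun i j hij => ?_, h2, fun i j k l hij hik hil hjk hjl hkl u hu => ?_⟩
  · by_contra hne
    exact h1 i j hne hij
  · exact h3 i j k l hij hik hil hjk hjl hkl (det3_eq_zero_of_tie hu.1 hu.2.1 hu.2.2)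

end Perturbation

/-! ### Shallow bounds for the admissible range spaces -/

theorem exists_forall_lt {α : Type*} [Finite α] (f : α → ℝ) : ∃ M, ∀ x, f x < M := by
  obtain ⟨M, hM⟩ := (Set.finite_range f).bddAbove
  exact ⟨M + 1, fun x => (hM ⟨x, rfl⟩).trans_lt (lt_add_one M)⟩

/-- The sets of at most `k` points cut off from below by non-vertical planes are linear in
number. -/
theorem card_le_of_separable {X : Type*} [Fintype X] [DecidableEq X] (p : X → ℝ × ℝ × ℝ) (k : ℕ)
    (𝓕 : Finset (Finset X)) (hcard : ∀ T ∈ 𝓕, #T ≤ k)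
    (hsep : ∀ T ∈ 𝓕, ∃ (u : ℝ × ℝ) (h : ℝ), (∀ x ∈ T, height (p x) u < h) ∧
      ∀ z ∉ T, h < height (p z) u) :
    #𝓕 ≤ 2 ^ (k + 9) * (Fintype.card X + 1) := by
  have hsep' : ∀ T : Finset X, ∃ (u : ℝ × ℝ) (h : ℝ), T ∈ 𝓕 → (∀ x ∈ T, height (p x) u < h) ∧
      ∀ z ∉ T, h < height (p z) u := by
    intro T
    by_cases hT : T ∈ 𝓕
    · obtain ⟨u, h, H⟩ := hsep T hT
      exact ⟨u, h, fun _ => H⟩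
    · exact ⟨0, 0, fun h => absurd h hT⟩
  choose u h hu using hsep'
  -- Two guard functions are added for the compactness in `exists_leftmost`: their first coefficient
  -- exceeds all others, their slopes lie beyond all others on either side, and their constant terms
  -- put them above level `h T` at every `u T`.
  obtain ⟨α, hα⟩ := exists_forall_lt fun x => (p x).1
  obtain ⟨β, hβ⟩ := exists_forall_lt fun x => (p x).2.1
  obtain ⟨β', hβ'⟩ := exists_forall_lt fun x => -(p x).2.1
  obtain ⟨γ, hγ⟩ := exists_forall_lt fun T => h T - (α * (u T).1 + β * (u T).2)
  obtain ⟨γ', hγ'⟩ := exists_forall_lt fun T => h T - (α * (u T).1 + -β' * (u T).2)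
  let p₀ : X ⊕ Bool → ℝ × ℝ × ℝ :=
    Sum.elim p fun b => if b then (α, β, γ) else (α, -β', γ')
  let κ : X ⊕ Bool → ℝ := fun i => (Fintype.equivFin (X ⊕ Bool) i : ℕ)
  have hκ : Function.Injective κ := fun i j hij => by
    simpa [κ, Fin.val_inj] using hij
  let q : ℝ → X ⊕ Bool → ℝ × ℝ × ℝ := fun t i => perturb (p₀ i) (κ i) t
  have hq0 : ∀ i, q 0 i = p₀ i := fun i => by simp [q, perturb]
  have hq : ∀ i, Continuous fun t => q t i := fun i => by
    simp only [q, perturb]; fun_prop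
  have hqh : ∀ i v, Continuous fun t => height (q t i) v := fun i v => by
    simp only [q, perturb, height]; fun_prop
  have ev1 : ∀ᶠ t in 𝓝[≠] (0 : ℝ), ∀ T ∈ 𝓕, ∀ x ∈ T, ∀ i ∈ (T.map Function.Embedding.inl)ᶜ,
      height (q t (Sum.inl x)) (u T) < height (q t i) (u T) := by
    rw [eventually_all_finset]; intro T hT
    rw [eventually_all_finset]; intro x hx
    rw [eventually_all_finset]; intro i hi
    refine ((hqh (Sum.inl x) (u T)).continuousAt.eventually_lt
      (hqh i (u T)).continuousAt ?_).filter_mono nhdsWithin_le_nhds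
    rw [hq0, hq0]
    refine ((hu T hT).1 x hx).trans ?_
    rcases i with z | b
    · refine (hu T hT).2 z fun hz => ?_
      simp [hz] at hi
    · rcases b with _ | _
      · have := hγ' T
        simp only [p₀, height, Sum.elim_inr, Bool.false_eq_true, if_false]
        linarith
      · have := hγ T
        simp only [p₀, height, Sum.elim_inr, if_true]
        linarith
  have ev2 : ∀ᶠ t in 𝓝[≠] (0 : ℝ), ∀ x : X,
      (q t (Sum.inl x)).1 < (q t (Sum.inr true)).1 ∧
      (q t (Sum.inl x)).1 < (q t (Sum.inr false)).1 ∧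
      (q t (Sum.inl x)).2.1 < (q t (Sum.inr true)).2.1 ∧
      (q t (Sum.inr false)).2.1 < (q t (Sum.inl x)).2.1 := by
    rw [eventually_all]
    intro x
    have c1 : ∀ i, ContinuousAt (fun t => (q t i).1) 0 := fun i => (hq i).fst.continuousAt
    have c2 : ∀ i, ContinuousAt (fun t => (q t i).2.1) 0 := fun i => (hq i).snd.fst.continuousAt
    have k1 := (c1 (Sum.inl x)).eventually_lt (c1 (Sum.inr true))
      (by rw [hq0, hq0]; simpa [p₀] using hα x)
    have k2 := (c1 (Sum.inl x)).eventually_lt (c1 (Sum.inr false))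
      (by rw [hq0, hq0]; simpa [p₀] using hα x)
    have k3 := (c2 (Sum.inl x)).eventually_lt (c2 (Sum.inr true))
      (by rw [hq0, hq0]; simpa [p₀] using hβ x)
    have k4 := (c2 (Sum.inr false)).eventually_lt (c2 (Sum.inl x))
      (by rw [hq0, hq0]; simpa [p₀] using neg_lt.1 (hβ' x))
    exact (k1.and (k2.and (k3.and k4))).filter_mono nhdsWithin_le_nhds
  obtain ⟨t, hgen, h1, h2⟩ := ((eventually_generic_perturb p₀ hκ).and (ev1.and ev2)).exists
  have hinj : Function.Injective fun T : Finset X =>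
      T.map (Function.Embedding.inl : X ↪ X ⊕ Bool) := map_injective _
  have hmain := card_le_of_separable_generic (p := q t) hgen (g := Sum.inr true)
    (g' := Sum.inr false) k ((𝓕.erase ∅).image fun T => T.map Function.Embedding.inl)
    (by
      intro S hS
      obtain ⟨T, hT, rfl⟩ := mem_image.1 hS
      exact (nonempty_iff_ne_empty.2 (ne_of_mem_erase hT)).map)
    (by
      intro S hS
      obtain ⟨T, hT, rfl⟩ := mem_image.1 hS
      rw [card_map]
      exact hcard T (mem_of_mem_erase hT))
    (by
      intro S hS
      obtain ⟨T, hT, rfl⟩ := mem_image.1 hS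
      simp)
    (by
      intro S hS
      obtain ⟨T, hT, rfl⟩ := mem_image.1 hS
      intro i hi
      obtain ⟨x, hx, rfl⟩ := mem_map.1 hi
      exact h2 x)
    (by
      intro S hS
      obtain ⟨T, hT, rfl⟩ := mem_image.1 hS
      refine ⟨u T, fun i hi z hz => ?_⟩
      obtain ⟨x, hx, rfl⟩ := mem_map.1 hi
      exact h1 T (mem_of_mem_erase hT) x hx z (mem_compl.2 hz))
  rw [card_image_of_injective _ hinj, Fintype.card_sum, Fintype.card_bool] at hmain
  -- The empty set and the two guards are absorbed by the factor 4 between 2^(k + 7) and 2^(k + 9).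
  have h3 : #𝓕 ≤ #(𝓕.erase ∅) + 1 := by
    have := pred_card_le_card_erase (s := 𝓕) (a := ∅)
    omega
  have h4 : 1 ≤ 2 ^ (k + 7) := Nat.one_le_two_pow
  have h5 : 2 ^ (k + 9) = 4 * 2 ^ (k + 7) := by ring
  rw [h5]
  nlinarith [Nat.zero_le (2 ^ (k + 7) * Fintype.card X)]

/-- A half-space section of a finite set can be cut off by a non-vertical plane, strictly. -/
theorem separable_of_halfSpace {X : Type*} [Fintype X] (p : X → ℝ × ℝ × ℝ) (T : Finset X)
    (α β γ c : ℝ) (hT : ∀ x, x ∈ T ↔ α * (p x).1 + β * (p x).2.1 + γ * (p x).2.2 ≤ c) :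
    (∃ (u : ℝ × ℝ) (h : ℝ), (∀ x ∈ T, height (p x) u < h) ∧ ∀ z ∉ T, h < height (p z) u) ∨
      ∃ (u : ℝ × ℝ) (h : ℝ), (∀ x ∈ T, height ((p x).1, (p x).2.1, -(p x).2.2) u < h) ∧
        ∀ z ∉ T, h < height ((p z).1, (p z).2.1, -(p z).2.2) u := by
  -- Raising `c` to `e` makes both sides strict, so `γ` can be moved to a nonzero `g`. The sign of
  -- `g` decides whether `T` is cut off from below or needs reflecting in the third coordinate.
  have ev1 : ∀ᶠ e in 𝓝[>] c, ∀ z, z ∉ T →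
      e < α * (p z).1 + β * (p z).2.1 + γ * (p z).2.2 := by
    simp only [eventually_all]
    intro z hz
    rw [hT, not_le] at hz
    exact (Iio_mem_nhds hz : _ ∈ 𝓝 c) |> fun h => nhdsWithin_le_nhds h
  obtain ⟨e, he, hce⟩ := (ev1.and self_mem_nhdsWithin).exists
  have hce : c < e := hce
  have hcont : ∀ x, ContinuousAt (fun g : ℝ => α * (p x).1 + β * (p x).2.1 + g * (p x).2.2) γ :=
    fun x => by fun_prop
  have ev2 : ∀ᶠ g in 𝓝[≠] γ, ∀ x, x ∈ T → α * (p x).1 + β * (p x).2.1 + g * (p x).2.2 < e := by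
    simp only [eventually_all]
    intro x hx
    exact ((hcont x).eventually_lt continuousAt_const
      (((hT x).1 hx).trans_lt hce)).filter_mono nhdsWithin_le_nhds
  have ev3 : ∀ᶠ g in 𝓝[≠] γ, ∀ x, x ∉ T → e < α * (p x).1 + β * (p x).2.1 + g * (p x).2.2 := by
    simp only [eventually_all]
    intro x hx
    exact (continuousAt_const.eventually_lt (hcont x) (he x hx)).filter_mono nhdsWithin_le_nhds
  have ev4 : ∀ᶠ g in 𝓝[≠] γ, g ≠ 0 := by
    by_cases hγ : γ = 0
    · rw [hγ]; exact self_mem_nhdsWithin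
    · exact (eventually_ne_nhds hγ).filter_mono nhdsWithin_le_nhds
  obtain ⟨g, h2, h3, h4⟩ := (ev2.and (ev3.and ev4)).exists
  rcases lt_or_gt_of_ne h4 with hneg | hpos
  · right
    have hg : 0 < -g := neg_pos.2 hneg
    have key : ∀ x, height ((p x).1, (p x).2.1, -(p x).2.2) (α / -g, β / -g) =
        (α * (p x).1 + β * (p x).2.1 + g * (p x).2.2) / -g := fun x => by
      simp only [height]; field_simp; ring
    refine ⟨(α / -g, β / -g), e / -g, fun x hx => ?_, fun z hz => ?_⟩
    · rw [key]; exact div_lt_div_of_pos_right (h2 x hx) hg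
    · rw [key]; exact div_lt_div_of_pos_right (h3 z hz) hg
  · left
    have key : ∀ x, height (p x) (α / g, β / g) =
        (α * (p x).1 + β * (p x).2.1 + g * (p x).2.2) / g := fun x => by
      simp only [height]; field_simp
    refine ⟨(α / g, β / g), e / g, fun x hx => ?_, fun z hz => ?_⟩
    · rw [key]; exact div_lt_div_of_pos_right (h2 x hx) hpos
    · rw [key]; exact div_lt_div_of_pos_right (h3 z hz) hpos

theorem shallowBound_of_halfSpaces {X : Type*} [DecidableEq X] (p : X → ℝ × ℝ × ℝ)
    {𝓡 : Finset (Finset X)}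
    (h : ∀ R ∈ 𝓡, ∃ α β γ c : ℝ, ∀ x,
      x ∈ R ↔ α * (p x).1 + β * (p x).2.1 + γ * (p x).2.2 ≤ c) :
    ShallowBound (fun k => 2 ^ (k + 10)) 𝓡 := by
  classical
  intro k Y
  set 𝓣 := {v ∈ 𝓡.image (· ∩ Y) | #v ≤ k} with h𝓣
  let φ : Finset X → Finset Y := fun v => v.subtype (· ∈ Y)
  have hφ : Set.InjOn φ 𝓣 := by
    have : ∀ v ∈ 𝓣, (φ v).map (Function.Embedding.subtype _) = v := by
      intro v hv
      obtain ⟨R, -, rfl⟩ := mem_image.1 (mem_filter.1 hv).1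
      rw [subtype_map]
      exact filter_true_of_mem fun x hx => (mem_inter.1 hx).2
    intro v hv v' hv' e
    rw [← this v hv, ← this v' hv', e]
  let pos : Finset Y → Prop := fun T => ∃ (u : ℝ × ℝ) (h : ℝ),
    (∀ x ∈ T, height (p x) u < h) ∧ ∀ z ∉ T, h < height (p z) u
  let neg : Finset Y → Prop := fun T => ∃ (u : ℝ × ℝ) (h : ℝ),
    (∀ x ∈ T, height ((p x).1, (p x).2.1, -(p x).2.2) u < h) ∧
      ∀ z ∉ T, h < height ((p z).1, (p z).2.1, -(p z).2.2) u
  have hsub : 𝓣.image φ ⊆ {T ∈ 𝓣.image φ | pos T} ∪ {T ∈ 𝓣.image φ | neg T} := by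
    intro T hT
    obtain ⟨v, hv, rfl⟩ := mem_image.1 hT
    obtain ⟨R, hR, rfl⟩ := mem_image.1 (mem_filter.1 hv).1
    obtain ⟨α, β, γ, c, hRc⟩ := h R hR
    rcases separable_of_halfSpace (fun x : Y => p x) (φ (R ∩ Y)) α β γ c (fun x => by
      rw [← hRc]; simp [φ]) with hs | hs
    · exact mem_union_left _ (mem_filter.2 ⟨hT, hs⟩)
    · exact mem_union_right _ (mem_filter.2 ⟨hT, hs⟩)
  have hk : ∀ T ∈ 𝓣.image φ, #T ≤ k := by
    intro T hT
    obtain ⟨v, hv, rfl⟩ := mem_image.1 hT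
    rw [card_subtype]
    exact (card_filter_le _ _).trans (mem_filter.1 hv).2
  have h1 := card_le_of_separable (fun x : Y => p x) k {T ∈ 𝓣.image φ | pos T}
    (fun T hT => hk T (mem_filter.1 hT).1) fun T hT => (mem_filter.1 hT).2
  have h2 := card_le_of_separable (fun x : Y => ((p x).1, (p x).2.1, -(p x).2.2)) k
    {T ∈ 𝓣.image φ | neg T} (fun T hT => hk T (mem_filter.1 hT).1) fun T hT => (mem_filter.1 hT).2
  rw [Fintype.card_coe] at h1 h2
  have h3 := (card_le_card hsub).trans (card_union_le _ _)
  rw [card_image_of_injOn hφ] at h3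
  have h4 : 2 ^ (k + 10) = 2 * 2 ^ (k + 9) := by ring
  simp only [h4]
  linarith

/-- Only the empty set and singletons are shattered, so even all traces number at most #Y + 1; the
weaker constant matches the one for half-spaces. -/
theorem shallowBound_of_vcDim_le_one {X : Type*} [DecidableEq X] {𝓡 : Finset (Finset X)}
    (h : 𝓡.vcDim ≤ 1) : ShallowBound (fun k => 2 ^ (k + 10)) 𝓡 := by
  intro k Y
  have hsub : (𝓡.image (· ∩ Y)).shatterer ⊆ insert ∅ (Y.image fun x => {x}) := by
    intro s hs
    rw [mem_shatterer] at hs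
    have hsY : s ⊆ Y := by
      obtain ⟨v, hv, hsv⟩ := hs.exists_superset
      obtain ⟨R, -, rfl⟩ := mem_image.1 hv
      exact hsv.trans inter_subset_right
    have hs1 : #s ≤ 1 := by
      refine (Shatters.card_le_vcDim fun t ht => ?_).trans h
      obtain ⟨v, hv, hvt⟩ := hs ht
      obtain ⟨R, hR, rfl⟩ := mem_image.1 hv
      refine ⟨R, hR, ?_⟩
      rw [← hvt, inter_comm R Y, ← inter_assoc, inter_eq_left.2 hsY]
    rcases Nat.le_one_iff_eq_zero_or_eq_one.1 hs1 with h0 | h0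
    · rw [card_eq_zero.1 h0]; exact mem_insert_self _ _
    · obtain ⟨x, rfl⟩ := card_eq_one.1 h0
      exact mem_insert_of_mem (mem_image_of_mem _ (singleton_subset_iff.1 hsY))
  calc #{v ∈ 𝓡.image (· ∩ Y) | #v ≤ k} ≤ #(𝓡.image (· ∩ Y)) := card_filter_le _ _
    _ ≤ #(𝓡.image (· ∩ Y)).shatterer := card_le_card_shatterer _
    _ ≤ #Y + 1 := (card_le_card hsub).trans ((card_insert_le _ _).trans
        (Nat.add_le_add_right card_image_le 1))
    _ ≤ 2 ^ (k + 10) * (#Y + 1) := Nat.le_mul_of_pos_left _ (by positivity)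

/-- Admissible range spaces have linearly many shallow traces. -/
theorem IsAdmissible.shallowBound {X : Type*} [DecidableEq X] {𝓡 : Finset (Finset X)}
    (h : IsAdmissible 𝓡) : ShallowBound (fun k => 2 ^ (k + 10)) 𝓡 := by
  rcases h with ⟨f, hf⟩ | ⟨f, hf⟩ | ⟨f, hf⟩ | ⟨f, hf⟩ | h
  · refine shallowBound_of_halfSpaces (fun x => (f x 0, f x 1, 0)) fun R hR => ?_
    obtain ⟨_, ⟨a, b, -, rfl⟩, hG⟩ := (hf R).1 hR
    refine ⟨a 0, a 1, 0, b, fun x => (hG x).trans ?_⟩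
    simp [PiLp.inner_apply, Fin.sum_univ_two, mul_comm]
  · refine shallowBound_of_halfSpaces (fun x => (f x 0, f x 1, f x 2)) fun R hR => ?_
    obtain ⟨_, ⟨a, b, -, rfl⟩, hG⟩ := (hf R).1 hR
    refine ⟨a 0, a 1, a 2, b, fun x => (hG x).trans ?_⟩
    simp [PiLp.inner_apply, Fin.sum_univ_three, mul_comm]
  -- On the paraboloid the inequality |x − c|² ≤ r² is linear.
  · refine shallowBound_of_halfSpaces (fun x => (f x 0, f x 1, f x 0 ^ 2 + f x 1 ^ 2))
      fun R hR => ?_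
    obtain ⟨_, ⟨c, r, hr, rfl⟩, hG⟩ := (hf R).1 hR
    refine ⟨-2 * c 0, -2 * c 1, 1, r ^ 2 - c 0 ^ 2 - c 1 ^ 2, fun x => (hG x).trans ?_⟩
    rw [Metric.mem_closedBall, EuclideanSpace.dist_eq, Real.sqrt_le_left hr.le,
      Fin.sum_univ_two, Real.dist_eq, Real.dist_eq, sq_abs, sq_abs]
    constructor <;> intro h <;> nlinarith
  -- On the parabola the inequality (x − a)(x − b) ≤ 0 is linear.
  · refine shallowBound_of_halfSpaces (fun x => (f x, 0, f x ^ 2)) fun R hR => ?_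
    obtain ⟨_, ⟨a, b, hab, rfl⟩, hG⟩ := (hf R).1 hR
    refine ⟨-(a + b), 0, 1, -(a * b), fun x => (hG x).trans ?_⟩
    rw [Set.mem_Icc]
    constructor
    · rintro ⟨h1, h2⟩
      nlinarith [mul_nonneg (sub_nonneg.2 h1) (sub_nonneg.2 h2)]
    · intro h
      simp only at h
      have h0 : (f x - a) * (f x - b) ≤ 0 := by linarith
      constructor <;> by_contra hlt <;> push Not at hlt
      · have := mul_pos_of_neg_of_neg (sub_neg.2 hlt) (sub_neg.2 (hlt.trans_le hab))
        linarith
      · have := mul_pos (sub_pos.2 (hab.trans_lt hlt)) (sub_pos.2 hlt)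
        linarith
  · exact shallowBound_of_vcDim_le_one h.le

/-! ### The VC-dimension is at least one; conclusion -/

theorem one_le_vcDim {X : Type*} [DecidableEq X] {𝓡 : Finset (Finset X)} {x : X}
    {A B : Finset X} (hA : A ∈ 𝓡) (hB : B ∈ 𝓡) (hxA : x ∈ A) (hxB : x ∉ B) : 1 ≤ 𝓡.vcDim := by
  rw [← card_singleton x]
  refine Shatters.card_le_vcDim fun t ht => ?_
  rcases subset_singleton_iff.1 ht with rfl | rfl
  · exact ⟨B, hB, singleton_inter_of_notMem hxB⟩
  · exact ⟨A, hA, singleton_inter_of_mem hxA⟩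

theorem IsInducedBy.one_le_vcDim {X E : Type*} [Fintype X] [DecidableEq X] [Nonempty X]
    {𝓖 : Set (Set E)} {𝓡 : Finset (Finset X)} (h : IsInducedBy 𝓖 𝓡)
    (h𝓖 : ∀ e, (∃ G ∈ 𝓖, e ∈ G) ∧ ∃ G ∈ 𝓖, e ∉ G) : 1 ≤ 𝓡.vcDim := by
  classical
  obtain ⟨f, hf⟩ := h
  obtain ⟨x⟩ := ‹Nonempty X›
  obtain ⟨⟨A, hA, hxA⟩, B, hB, hxB⟩ := h𝓖 (f x)
  exact RangeSpace.one_le_vcDim (x := x) (A := univ.filter fun y => f y ∈ A)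
    (B := univ.filter fun y => f y ∈ B)
    ((hf _).2 ⟨A, hA, by simp⟩) ((hf _).2 ⟨B, hB, by simp⟩) (by simpa) (by simpa)

theorem exists_halfSpace_mem_and_notMem {n : ℕ} [NeZero n] (e : EuclideanSpace ℝ (Fin n)) :
    (∃ G ∈ halfSpaces n, e ∈ G) ∧ ∃ G ∈ halfSpaces n, e ∉ G := by
  have ha : EuclideanSpace.single (0 : Fin n) (1 : ℝ) ≠ 0 := by simp
  refine ⟨⟨_, ⟨_, _, ha, rfl⟩, le_refl (inner ℝ (EuclideanSpace.single 0 1) e)⟩,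
    _, ⟨_, inner ℝ (EuclideanSpace.single 0 1) e - 1, ha, rfl⟩, ?_⟩
  simp

/-- The net bound of `exists_epsNet` has no factor d, so 1 ≤ d is all that is needed to insert it.
-/
theorem IsAdmissible.one_le_vcDim {X : Type*} [Fintype X] [DecidableEq X] [Nonempty X]
    {𝓡 : Finset (Finset X)} (h : IsAdmissible 𝓡) : 1 ≤ 𝓡.vcDim := by
  rcases h with h | h | h | h | h
  · exact h.one_le_vcDim exists_halfSpace_mem_and_notMem
  · exact h.one_le_vcDim exists_halfSpace_mem_and_notMem
  · refine h.one_le_vcDim fun e => ⟨⟨_, ⟨e, 1, one_pos, rfl⟩, by simp⟩,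
      _, ⟨e + EuclideanSpace.single 0 2, 1, one_pos, rfl⟩, ?_⟩
    simp [Metric.mem_closedBall, dist_eq_norm]
  · refine h.one_le_vcDim fun e => ⟨⟨_, ⟨e, e, le_rfl, rfl⟩, by simp⟩,
      _, ⟨e + 1, e + 1, le_rfl, rfl⟩, by simp⟩
  · exact h.ge

end RangeSpace

theorem lemma13 :
    (∃ C : ℝ, 0 < C ∧
      ∀ (X : Type u) [Fintype X] [DecidableEq X] [MeasurableSpace X] [MeasurableSingletonClass X]
        (P : Measure X) [IsProbabilityMeasure P] (𝓡 : Finset (Finset X)),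
        RangeSpace.IsAdmissible 𝓡 → ∀ ε : ℝ, 0 < ε →
          (RangeSpace.doublingConstant P 𝓡 ε : ℝ) ≤ C * RangeSpace.capacity P 𝓡 ε) ∧
    (∀ a : ℝ, a < 1 → ∃ C : ℝ, 0 < C ∧
      ∀ (X : Type u) [Fintype X] [DecidableEq X] [MeasurableSpace X] [MeasurableSingletonClass X]
        (P : Measure X) [IsProbabilityMeasure P] (𝓡 : Finset (Finset X)),
        RangeSpace.IsAdmissible 𝓡 → ∀ ε : ℝ, 0 < ε → ε ≤ a →
          ∃ S : Finset X, RangeSpace.IsEpsNet P 𝓡 ε S ∧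
            (S.card : ℝ) ≤ C * (𝓡.vcDim : ℝ) *
              min (RangeSpace.capacity P 𝓡 ε * Real.log (1 / ε)) (1 / ε)) := by
  constructor
  · obtain ⟨K, hK, h⟩ := RangeSpace.exists_doublingConstant_le.{u} fun k => 2 ^ (k + 10)
    exact ⟨K, hK, fun X _ _ _ _ P _ 𝓡 h𝓡 ε hε => h X P 𝓡 h𝓡.shallowBound ε hε⟩
  · intro a ha
    obtain ⟨K, hK, h⟩ := RangeSpace.exists_epsNet.{u} (fun k => 2 ^ (k + 10)) ha
    refine ⟨K, hK, fun X _ _ _ _ P _ 𝓡 h𝓡 ε hε hεa => ?_⟩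
    obtain ⟨S, hS, hcard⟩ := h X P 𝓡 h𝓡.shallowBound ε hε hεa
    have : Nonempty X := P.nonempty_of_neZero
    have hd : (1 : ℝ) ≤ 𝓡.vcDim := by exact_mod_cast h𝓡.one_le_vcDim
    have hτ : (0 : ℝ) ≤ RangeSpace.capacity P 𝓡 ε := zero_le_one.trans (le_max_right _ _)
    have hlog : 0 ≤ Real.log (1 / ε) :=
      Real.log_nonneg (by rw [le_div_iff₀ hε]; linarith)
    refine ⟨S, hS, hcard.trans ?_⟩
    exact mul_le_mul_of_nonneg_right (le_mul_of_one_le_right hK.le hd)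
      (le_min (mul_nonneg hτ hlog) (by positivity))
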